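/- Let $p$ be an odd prime, let $k$ and $e=2m$ be positive integers, let $d=\gcd(k,e)$, suppose that $e/d$ is even, and put $q=p^e$ and $s=m/d$. Let $\mathrm{Tr}$ be the absolute trace from $\mathbb{F}_q$ to $\mathbb{F}_p$, let $a\in\mathbb{F}_q^*$, let $D_0=\{x\in\mathbb{F}_q^*:\mathrm{Tr}(ax^{p^k+1})=0\}$ and let $C_{D_0}=\{(\mathrm{Tr}(bx))_{x\in D_0}: b\in\mathbb{F}_q\}$, a linear code over $\mathbb{F}_p$ of length $\#D_0$. Its weight enumerator is $1+\sum_{i\ge 1}A_iz^i$, where $A_i$ is the number of codewords of Hamming weight $i$; its complete weight enumerator is $\sum_{\mathsf{c}\in C_{D_0}}\prod_{\rho\in\mathbb{F}_p}w_\rho^{k_\rho(\mathsf{c})}$, where $k_\rho(\mathsf{c})$ is the number of components of $\mathsf{c}$ equal to $\rho$. Assume that $m>d+1$ and $a^{(q-1)/(p^d+1)}=(-1)^s$. Then $C_{D_0}$ is a three-weight linear code (exactly three of the numbers $A_i$, $i\ge1$, are nonzero) of length $p^{e-1}-(-1)^s(p-1)p^{m+d-1}-1$ and dimension $e$, with weight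 enumerator \begin{align*} 1&+(p^e-p^{e-2d})\,z^{(p-1)(p^{e-2}-(-1)^s(p-1)p^{m+d-2})} +(p^{e-2d-1}-(-1)^s(p-1)p^{m-d-1}-1)\,z^{(p-1)p^{e-2}}\\ &+(p-1)(p^{e-2d-1}+(-1)^sp^{m-d-1})\,z^{(p-1)(p^{e-2}-(-1)^sp^{m+d-1})}, \end{align*} and its complete weight enumerator is \begin{align*} &w_0^{p^{e-1}-(-1)^s(p-1)p^{m+d-1}-1} +(p^e-p^{e-2d})\,w_0^{p^{e-2}-(-1)^s(p-1)p^{m+d-2}-1}\prod_{\rho\in\mathbb{F}_p^*}w_\rho^{p^{e-2}-(-1)^s(p-1)p^{m+d-2}}\\ &+(p^{e-2d-1}-(-1)^s(p-1)p^{m-d-1}-1)\,w_0^{p^{e-2}-(-1)^s(p-1)p^{m+d-1}-1}\prod_{\rho\in\mathbb{F}_p^*}w_\rho^{p^{e-2}}\\ &+(p-1)(p^{e-2d-1}+(-1)^sp^{m-d-1})\,w_0^{p^{e-2}-1}\prod_{\rho\in\mathbb{F}_p^*}w_\rho^{p^{e-2}-(-1)^sp^{m+d-1}}. \end{align*} 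-/

import Mathlib

namespace CodeD

section General

variable {K ι : Type*} [Field K] [Fintype K] [DecidableEq K] [Fintype ι]

/-- A linear code over `K` whose coordinates are indexed by the finite set `ι` is a subspace of
`ι → K`. It is an `[n, κ]` code if its length is `n` and its dimension is `κ`. -/
def IsCodeWithParameters (C : Submodule K (ι → K)) (n κ : ℕ) : Prop :=
  Fintype.card ι = n ∧ Module.finrank K C = κ

/-- `A_i`: the number of codewords of Hamming weight `i`. -/
noncomputable def weightCount (C : Submodule K (ι → K)) (i : ℕ) : ℕ :=
  Set.ncard {c : ι → K | c ∈ C ∧ hammingNorm c = i}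

/-- The weight enumerator `1 + A_1 z + A_2 z ^ 2 + ⋯ + A_n z ^ n` of a code of length `n`. -/
noncomputable def weightEnumerator (C : Submodule K (ι → K)) : Polynomial ℤ :=
  1 + ∑ i ∈ Finset.Icc 1 (Fintype.card ι),
    Polynomial.C (weightCount C i : ℤ) * Polynomial.X ^ i

/-- A `t`-weight code: exactly `t` of the numbers `A_1, …, A_n` are nonzero. -/
def IsWeightCode (C : Submodule K (ι → K)) (t : ℕ) : Prop :=
  ((Finset.Icc 1 (Fintype.card ι)).filter fun i => weightCount C i ≠ 0).card = t

/-- The number of components of the word `c` that are equal to `ρ`. -/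
def symbolCount (c : ι → K) (ρ : K) : ℕ :=
  (Finset.univ.filter fun i => c i = ρ).card

open Classical in
/-- The complete weight enumerator `∑_{c ∈ C} ∏_ρ w_ρ ^ (number of components of c equal to ρ)`,
in the variables `w_ρ`, `ρ ∈ K`. -/
noncomputable def completeWeightEnumerator (C : Submodule K (ι → K)) : MvPolynomial K ℤ :=
  ∑ c ∈ Finset.univ.filter (fun c : ι → K => c ∈ C),
    ∏ ρ : K, MvPolynomial.X ρ ^ symbolCount c ρ

end General

section Construction

variable (p : ℕ) [Fact p.Prime] {F : Type*} [Field F] [Algebra (ZMod p) F]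

open Classical in
/-- `D_c = {x ∈ F, x ≠ 0 : Tr (a x ^ (p ^ k + 1)) = c}`, `Tr` being the absolute trace. -/
noncomputable def definingSet [Fintype F] (k : ℕ) (a : F) (c : ZMod p) : Finset F :=
  Finset.univ.filter fun x : F =>
    x ≠ 0 ∧ Algebra.trace (ZMod p) F (a * x ^ (p ^ k + 1)) = c

/-- The code `C_D = {(Tr (b x))_{x ∈ D} : b ∈ F}` with defining set `D`. -/
noncomputable def traceCode (D : Finset F) : Submodule (ZMod p) (D → ZMod p) :=
  LinearMap.range (LinearMap.pi fun x : D =>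
    (Algebra.trace (ZMod p) F).comp (LinearMap.mulRight (ZMod p) (x : F)))

theorem mem_traceCode (D : Finset F) (c : D → ZMod p) :
    c ∈ traceCode p D ↔
      ∃ b : F, c = fun x : D => Algebra.trace (ZMod p) F (b * (x : F)) := by
  constructor
  · rintro ⟨b, rfl⟩
    exact ⟨b, rfl⟩
  · rintro ⟨b, rfl⟩
    exact ⟨b, rfl⟩

end Construction

end CodeD

/-!
Let `Q x = Tr (a x ^ (p ^ k + 1))`, a quadratic form on `𝔽_q` over `𝔽_p`, written as `β x x` for the
bilinear form `β x y = Tr (a x ^ (p ^ k) y)` (`traceBilin`). Its polar form is `β + β.flip`.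

The number of `x` with `Q x = 0` and `Tr (b x) = ρ` is a combination of the character sums
`∑ x, ψ (y Q x + z Tr (b x))`. If the functional `Tr (b x)` is not of the form `B(w, x)` for the
polar form `B`, such a sum with `z ≠ 0` vanishes: its product with the conjugate of
`∑ x, ψ (y Q x)` is zero (`quadSum_eq_zero`). If it is `B(w, x)`, completing the square reduces the
sum to `∑ x, ψ (y Q x)` (`quadSum_polar`), and the result depends on whether `Q w` vanishes. This
gives the three classes of nonzero codewords (`isSymbolClassification_traceEncode`). The classes are
counted along the fibres of `w ↦ B(w, ·)`, which are the cosets of the radical (`card_polarClass`).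

It remains to know the order of the radical and the value `S` of the character sum of `Q`. A nonzero
`w` lies in the radical iff `w ^ (p ^ (2 k) - 1) = -a ^ (1 - p ^ k)`; under the condition on `a`
this equation is solvable, so the radical has order `p ^ (2 d)` (`card_radical_traceBilin`) and
`S ^ 2 = p ^ (2 (m + d))`. All elements of `𝔽_p` other than `0` are `(p ^ k + 1)`-th powers in
`𝔽_q`, so `Q` takes its nonzero values equally often and `S` is the integer `#{Q = 0} - #{Q = 1}`,
the same for all multiples of `Q`. Finally `x ^ (p ^ k + 1)` depends on `x ^ (p ^ d + 1)` only,
whence `S ≡ 1` modulo `p ^ d + 1`, while `p ^ (m + d) ≡ (-1) ^ (s + 1)`. As `p ^ d + 1 > 2`, this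
determines the sign: `S = -(-1) ^ s p ^ (m + d)` (`quadSum_traceBilin`).
-/

/-! ### Character sums of quadratic forms -/

section CharacterSums

open Finset

variable {K V : Type*} [Field K] [AddCommGroup V] [Module K V]

/-- The quadratic form of `β` is constant on the cosets of the radical of its polar form. -/
theorem quad_eq_of_polar_eq (h2 : (2 : K) ≠ 0) (β : LinearMap.BilinForm K V) {w w' : V}
    (h : (β + β.flip) w = (β + β.flip) w') : β w w = β w' w' := by
  have h1 : β w w + β w w = β w' w + β w w' := by simpa using DFunLike.congr_fun h w
  have h3 : β w w' + β w' w = β w' w' + β w' w' := by simpa using DFunLike.congr_fun h w'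
  apply mul_left_cancel₀ h2
  linear_combination h1 + h3

/-- If all nonzero values of `f` are taken equally often, its character sums are integers. -/
theorem sum_addChar_comp {X : Type*} [Fintype X] [Fintype K] [DecidableEq K]
    {ψ : AddChar K ℂ} (hψ : ψ ≠ 1) (f : X → K)
    (hf : ∀ c, c ≠ 0 → #{x | f x = c} = #{x | f x = 1}) :
    ∑ x, ψ (f x) = ((#{x | f x = 0} - #{x | f x = 1} : ℤ) : ℂ) := by
  have h : ∑ x, ψ (f x) = ∑ c, (#{x | f x = c} : ℂ) * ψ c := by
    rw [← sum_fiberwise univ f]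
    refine sum_congr rfl fun c _ => ?_
    rw [sum_congr rfl fun x hx => by rw [(mem_filter.mp hx).2]]
    simp
  have h1 : ∑ c ∈ univ.erase 0, ψ c = -1 := by
    have := AddChar.sum_eq_zero_of_ne_one hψ
    rw [← add_sum_erase _ _ (mem_univ (0 : K)), AddChar.map_zero_eq_one] at this
    linear_combination this
  rw [h, ← add_sum_erase _ _ (mem_univ (0 : K)),
    sum_congr rfl fun c hc => by rw [hf c (ne_of_mem_erase hc)], ← mul_sum, h1]
  simp [sub_eq_add_neg]

variable [Fintype V]

open Classical in
theorem sum_addChar_linear {ψ : AddChar K ℂ} (hψ : ψ ≠ 1) (ℓ : V →ₗ[K] K) :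
    ∑ v, ψ (ℓ v) = if ℓ = 0 then (Fintype.card V : ℂ) else 0 := by
  split_ifs with h
  · simp [h]
  · have hne : ψ.compAddMonoidHom ℓ.toAddMonoidHom ≠ 1 := by
      intro h1
      apply hψ
      ext c
      obtain ⟨v, hv⟩ := LinearMap.surjective h c
      have := DFunLike.congr_fun h1 v
      simpa [hv] using this
    simpa using AddChar.sum_eq_zero_of_ne_one hne

theorem sum_addChar_mul [Fintype K] [DecidableEq K] {ψ : AddChar K ℂ} (hψ : ψ ≠ 1) (c : K) :
    ∑ y, ψ (y * c) = if c = 0 then (Fintype.card K : ℂ) else 0 := by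
  have := AddChar.sum_mulShift c (AddChar.IsPrimitive.of_ne_one hψ)
  rw [this]
  split_ifs <;> simp

open Classical in
/-- Multiplying an inhomogeneous quadratic character sum by the conjugate of the homogeneous one
and substituting `x = u + y` makes the sum over `y` linear; only those `u` survive for which the
polar form at `u` cancels `ℓ`. -/
theorem quadSum_mul_quadSum_neg {ψ : AddChar K ℂ} (hψ : ψ ≠ 1) (β : LinearMap.BilinForm K V)
    (ℓ : V →ₗ[K] K) :
    (∑ x, ψ (β x x + ℓ x)) * ∑ y, ψ (-β y y) =
      ∑ u, ψ (β u u + ℓ u) *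
        if (β + β.flip) u + ℓ = 0 then (Fintype.card V : ℂ) else 0 := by
  simp_rw [← sum_addChar_linear hψ]
  rw [sum_mul_sum, sum_comm]
  simp_rw [mul_sum]
  rw [sum_comm (s := univ (α := V)) (f := fun u y => ψ (β u u + ℓ u) * _)]
  refine sum_congr rfl fun y _ => ?_
  refine (Fintype.sum_equiv (Equiv.addRight y) _ _ fun u => ?_).symm
  rw [← AddChar.map_add_eq_mul, ← AddChar.map_add_eq_mul]
  congr 1
  simp
  ring

/-- If `ℓ` is not represented by the polar form of `β`, then the quadratic character sum shifted
by `ℓ` vanishes, provided the unshifted one does not. -/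
theorem quadSum_eq_zero {ψ : AddChar K ℂ} (hψ : ψ ≠ 1) (β : LinearMap.BilinForm K V)
    (ℓ : V →ₗ[K] K) (h0 : ∑ y, ψ (-β y y) ≠ 0) (hℓ : ∀ w, (β + β.flip) w ≠ ℓ) :
    ∑ x, ψ (β x x + ℓ x) = 0 := by
  classical
  have h := quadSum_mul_quadSum_neg hψ β ℓ
  rw [sum_eq_zero (s := univ (α := V)) (f := fun u => ψ (β u u + ℓ u) * _), mul_eq_zero] at h
  · exact h.resolve_right h0
  · intro u _
    rw [if_neg, mul_zero]
    intro hu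
    apply hℓ (-u)
    rw [map_neg, neg_eq_iff_add_eq_zero, hu]

/-- Completing the square. -/
theorem quadSum_polar (ψ : AddChar K ℂ) (β : LinearMap.BilinForm K V) {y : K} (hy : y ≠ 0)
    (z : K) (w : V) :
    ∑ x, ψ (y * β x x + z * (β + β.flip) w x) =
      ψ (y⁻¹ * -(z ^ 2 * β w w)) * ∑ x, ψ (y * β x x) := by
  rw [mul_sum]
  refine Fintype.sum_equiv (Equiv.addRight ((z / y) • w)) _ _ fun u => ?_
  rw [← AddChar.map_add_eq_mul]
  congr 1
  simp
  field_simp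
  ring

/-- The square of the modulus of a quadratic character sum is the order of the space times the
order of the radical. -/
theorem quadSum_mul_self {ψ : AddChar K ℂ} (hψ : ψ ≠ 1) (h2 : (2 : K) ≠ 0)
    (β : LinearMap.BilinForm K V) [DecidablePred fun u => (β + β.flip) u = 0] :
    (∑ x, ψ (β x x)) * ∑ y, ψ (-β y y) =
      Fintype.card V * #{u : V | (β + β.flip) u = 0} := by
  classical
  have h := quadSum_mul_quadSum_neg hψ β 0
  simp only [LinearMap.zero_apply, add_zero] at h
  rw [h, card_eq_sum_ones, sum_filter, Nat.cast_sum, mul_sum]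
  refine sum_congr rfl fun u _ => ?_
  split_ifs with hu
  · have h1 : β u u + β u u = 0 := by simpa using DFunLike.congr_fun hu u
    have h3 : β u u = 0 := by
      rw [← two_mul] at h1
      exact (mul_eq_zero.mp h1).resolve_left h2
    simp [h3]
  · simp

variable [Fintype K] [DecidableEq K]

/-- The number of zeros of the quadratic form `β x x` on the affine hyperplane `ℓ x = ρ`, by
orthogonality of characters. -/
theorem card_zeros_on_hyperplane {ψ : AddChar K ℂ} (hψ : ψ ≠ 1) (β : LinearMap.BilinForm K V)
    {ℓ : V →ₗ[K] K} (hℓ : ℓ ≠ 0) (ρ : K) :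
    (Fintype.card K : ℂ) ^ 2 * #{x : V | β x x = 0 ∧ ℓ x = ρ} =
      Fintype.card V +
        ∑ y ∈ univ.erase 0, ∑ z, ψ (z * -ρ) * ∑ x, ψ (y * β x x + z * ℓ x) := by
  classical
  have key : (Fintype.card K : ℂ) ^ 2 * #{x : V | β x x = 0 ∧ ℓ x = ρ} =
      ∑ y, ∑ z, ψ (z * -ρ) * ∑ x, ψ (y * β x x + z * ℓ x) := by
    have h1 : ∀ x, (if β x x = 0 ∧ ℓ x = ρ then (Fintype.card K : ℂ) ^ 2 else 0) =
        (∑ y, ψ (y * β x x)) * ∑ z, ψ (z * (ℓ x - ρ)) := by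
      intro x
      rw [sum_addChar_mul hψ, sum_addChar_mul hψ]
      by_cases h : β x x = 0 <;> by_cases h' : ℓ x = ρ <;> simp [h, h', sub_eq_zero, sq]
    rw [card_eq_sum_ones, sum_filter, Nat.cast_sum, mul_sum]
    calc _ = ∑ x, (∑ y, ψ (y * β x x)) * ∑ z, ψ (z * (ℓ x - ρ)) := by
          refine sum_congr rfl fun x _ => ?_
          rw [← h1]
          split_ifs <;> simp
      _ = _ := by
          simp_rw [sum_mul_sum, mul_sum]
          rw [sum_comm]
          refine sum_congr rfl fun y _ => ?_
          rw [sum_comm]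
          refine sum_congr rfl fun z _ => sum_congr rfl fun x _ => ?_
          rw [← AddChar.map_add_eq_mul, ← AddChar.map_add_eq_mul]
          congr 1
          ring
  rw [key, ← add_sum_erase _ _ (mem_univ (0 : K))]
  congr 1
  have h2 : ∀ z : K, ∑ x, ψ (0 * β x x + z * ℓ x) =
      if z = 0 then (Fintype.card V : ℂ) else 0 := by
    intro z
    have := sum_addChar_linear hψ (z • ℓ)
    simp only [LinearMap.smul_apply, smul_eq_mul] at this
    simp only [zero_mul, zero_add, this, smul_eq_zero, hℓ, or_false]
  simp_rw [h2]
  simp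

theorem card_zeros {ψ : AddChar K ℂ} (hψ : ψ ≠ 1) (β : LinearMap.BilinForm K V) {S : ℤ}
    (hS : ∀ y : K, y ≠ 0 → ∑ x, ψ (y * β x x) = S) :
    (Fintype.card K : ℤ) * #{x : V | β x x = 0} =
    Fintype.card V + (Fintype.card K - 1) * S := by
  have h : (Fintype.card K : ℂ) * #{x : V | β x x = 0} =
      Fintype.card V + (Fintype.card K - 1) * S := by
    rw [card_eq_sum_ones, sum_filter, Nat.cast_sum, mul_sum]
    calc _ = ∑ x, ∑ y, ψ (y * β x x) := by
          refine sum_congr rfl fun x _ => ?_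
          rw [sum_addChar_mul hψ]
          split_ifs <;> simp
      _ = ∑ y, ∑ x, ψ (y * β x x) := sum_comm
      _ = _ := by
          rw [← add_sum_erase _ _ (mem_univ (0 : K)),
            sum_congr rfl fun y hy => hS y (ne_of_mem_erase hy)]
          simp [card_erase_of_mem, Nat.cast_sub Fintype.card_pos]
  exact_mod_cast h

/-- On a hyperplane that is not polar the zeros do not depend on the level `ρ`: only the terms with
`z = 0` of the character sum survive. -/
theorem card_zeros_of_not_polar {ψ : AddChar K ℂ} (hψ : ψ ≠ 1) (β : LinearMap.BilinForm K V) {S : ℤ}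
    (hS : ∀ y : K, y ≠ 0 → ∑ x, ψ (y * β x x) = S)
    (hS0 : S ≠ 0) {ℓ : V →ₗ[K] K}
    (hℓ : ∀ w, (β + β.flip) w ≠ ℓ) (ρ : K) :
    (Fintype.card K : ℤ) ^ 2 * #{x : V | β x x = 0 ∧ ℓ x = ρ} =
      Fintype.card V + (Fintype.card K - 1) * S := by
  have hℓ0 : ℓ ≠ 0 := fun h => hℓ 0 (by rw [h, map_zero])
  have hT : ∀ y : K, y ≠ 0 → ∀ z : K,
      ∑ x, ψ (y * β x x + z * ℓ x) = if z = 0 then (S : ℂ) else 0 := by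
    intro y hy z
    split_ifs with hz
    · simpa [hz] using hS y hy
    · have h := quadSum_eq_zero hψ (y • β) (z • ℓ) ?_ ?_
      · simpa using h
      · have := hS (-y) (neg_ne_zero.mpr hy)
        simp only [neg_mul] at this
        simpa [this] using hS0
      · intro w hw
        apply hℓ ((z⁻¹ * y) • w)
        have h3 : (β + β.flip) (y • w) = z • ℓ := by
          rw [← hw]
          ext v
          simp
        rw [mul_smul, map_smul, h3, smul_smul, inv_mul_cancel₀ hz, one_smul]
  have h := card_zeros_on_hyperplane hψ β hℓ0 ρ
  rw [sum_congr rfl fun y hy => sum_congr rfl fun z _ => by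
    rw [hT y (ne_of_mem_erase hy) z]] at h
  simp only [mul_ite, mul_zero, sum_ite_eq', mem_univ, if_true, zero_mul, AddChar.map_zero_eq_one,
    one_mul, sum_const, card_erase_of_mem, card_univ, nsmul_eq_mul,
    Nat.cast_sub Fintype.card_pos, Nat.cast_one] at h
  exact_mod_cast h

/-- A functional polar to a singular vector `w`: completing the square contributes no factor. -/
theorem card_zeros_of_polar_isotropic {ψ : AddChar K ℂ} (hψ : ψ ≠ 1)
    (β : LinearMap.BilinForm K V) {S : ℤ}
    (hS : ∀ y : K, y ≠ 0 → ∑ x, ψ (y * β x x) = S)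
    {w : V} (hw : (β + β.flip) w ≠ 0) (hQ : β w w = 0) (ρ : K) :
    (Fintype.card K : ℤ) ^ 2 * #{x : V | β x x = 0 ∧ (β + β.flip) w x = ρ} =
      Fintype.card V + if ρ = 0 then Fintype.card K * (Fintype.card K - 1) * S else 0 := by
  have h := card_zeros_on_hyperplane hψ β hw ρ
  rw [sum_congr rfl fun y hy => sum_congr rfl fun z _ => by
    rw [quadSum_polar ψ β (ne_of_mem_erase hy), hS y (ne_of_mem_erase hy)]] at h
  simp only [hQ, mul_zero, neg_zero, AddChar.map_zero_eq_one, one_mul, ← sum_mul,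
    sum_addChar_mul hψ, neg_eq_zero, sum_const, card_erase_of_mem, mem_univ, card_univ,
    nsmul_eq_mul, Nat.cast_sub Fintype.card_pos, Nat.cast_one] at h
  split_ifs at h ⊢
  · have h' : (Fintype.card K : ℂ) ^ 2 * #{x : V | β x x = 0 ∧ (β + β.flip) w x = ρ} =
      Fintype.card V + Fintype.card K * (Fintype.card K - 1) * S := by rw [h]; ring
    exact_mod_cast h'
  · rw [mul_zero, zero_mul] at h
    exact_mod_cast h

/-- A functional polar to a nonsingular vector `w`: completing the square contributes the factor
`ψ (-z ^ 2 * β w w / y)`. -/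
theorem card_zeros_of_polar_anisotropic {ψ : AddChar K ℂ} (hψ : ψ ≠ 1)
    (β : LinearMap.BilinForm K V) {S : ℤ}
    (hS : ∀ y : K, y ≠ 0 → ∑ x, ψ (y * β x x) = S)
    {w : V} (hw : (β + β.flip) w ≠ 0) (hQ : β w w ≠ 0)
    (ρ : K) :
    (Fintype.card K : ℤ) ^ 2 * #{x : V | β x x = 0 ∧ (β + β.flip) w x = ρ} =
      Fintype.card V + if ρ = 0 then 0 else Fintype.card K * S := by
  have h := card_zeros_on_hyperplane hψ β hw ρ
  rw [sum_congr rfl fun y hy => sum_congr rfl fun z _ => by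
    rw [quadSum_polar ψ β (ne_of_mem_erase hy), hS y (ne_of_mem_erase hy)], sum_comm] at h
  -- The nonzero `y` are summed through their inverses, which turns the sum into a linear one.
  have hinv : ∀ c : K, ∑ y ∈ univ.erase 0, ψ (y⁻¹ * c) =
      (if c = 0 then (Fintype.card K : ℂ) else 0) - 1 := by
    intro c
    rw [← sum_addChar_mul hψ, ← add_sum_erase _ _ (mem_univ (0 : K)), zero_mul,
      AddChar.map_zero_eq_one, add_sub_cancel_left]
    exact sum_bij' (fun y _ => y⁻¹) (fun y _ => y⁻¹) (by simp) (by simp) (by simp) (by simp)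
      (by simp)
  have hz : ∀ z : K, (∑ y ∈ univ.erase 0, ψ (z * -ρ) * (ψ (y⁻¹ * -(z ^ 2 * β w w)) * (S : ℂ))) =
      ((if z = 0 then (Fintype.card K : ℂ) else 0) - ψ (z * -ρ)) * S := by
    intro z
    rw [← mul_sum, ← sum_mul, hinv]
    by_cases hz : z = 0 <;> simp [hz, hQ]
  simp only [hz, ← sum_mul, sum_sub_distrib, sum_ite_eq', mem_univ, if_true,
    sum_addChar_mul hψ, neg_eq_zero] at h
  split_ifs at h ⊢
  · rw [sub_self, zero_mul] at h
    exact_mod_cast h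
  · rw [sub_zero] at h
    exact_mod_cast h

end CharacterSums

/-! ### Enumerators of codes whose words fall into symbol classes -/

section CodesByClasses

open Finset

variable {K ι V : Type*} [Field K] [Fintype K] [DecidableEq K] [Fintype ι]

theorem hammingNorm_eq_sum_symbolCount (c : ι → K) :
    hammingNorm c = ∑ ρ ∈ univ.erase 0, CodeD.symbolCount c ρ := by
  unfold hammingNorm CodeD.symbolCount
  rw [card_eq_sum_card_fiberwise (f := c) (t := univ.erase 0) (by intro i; simp)]
  refine sum_congr rfl fun ρ hρ => ?_
  congr 1
  ext i
  simp only [mem_filter, mem_univ, true_and, and_iff_right_iff_imp]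
  rintro rfl
  exact ne_of_mem_erase hρ

variable [AddCommGroup V] [Module K V]

/-- The messages `b ≠ 0` are sorted by `t` into `r` classes; the words encoding those of class `j`
have `v j` components equal to `0` and `u j` components equal to `ρ`, for each `ρ ≠ 0`. -/
structure IsSymbolClassification {r : ℕ} (φ : V →ₗ[K] ι → K) (t : V → Fin r) (u v : Fin r → ℕ) :
    Prop where
  pos : ∀ j, 0 < u j
  symbolCount_eq : ∀ b, b ≠ 0 → ∀ ρ,
    CodeD.symbolCount (φ b) ρ = if ρ = 0 then v (t b) else u (t b)

namespace IsSymbolClassification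

variable {r : ℕ} {φ : V →ₗ[K] ι → K} {t : V → Fin r} {u v : Fin r → ℕ}

theorem hammingNorm_eq (h : IsSymbolClassification φ t u v) {b : V} (hb : b ≠ 0) :
    hammingNorm (φ b) = (Fintype.card K - 1) * u (t b) := by
  rw [hammingNorm_eq_sum_symbolCount]
  rw [sum_congr rfl fun ρ hρ => by rw [h.symbolCount_eq b hb, if_neg (ne_of_mem_erase hρ)]]
  simp [card_erase_of_mem]

theorem weight_pos (h : IsSymbolClassification φ t u v) (j : Fin r) :
    0 < (Fintype.card K - 1) * u j :=
  Nat.mul_pos (Nat.sub_pos_of_lt Fintype.one_lt_card) (h.pos j)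

theorem injective (h : IsSymbolClassification φ t u v) : Function.Injective φ := by
  rw [injective_iff_map_eq_zero]
  intro b hb
  by_contra hb0
  have := h.hammingNorm_eq hb0
  rw [hb, hammingNorm_zero] at this
  exact (h.weight_pos (t b)).ne this

theorem weight_le (h : IsSymbolClassification φ t u v) {b : V} (hb : b ≠ 0) :
    (Fintype.card K - 1) * u (t b) ≤ Fintype.card ι := by
  rw [← h.hammingNorm_eq hb]
  exact hammingNorm_le_card_fintype

variable [Fintype V] [DecidableEq V]

theorem weightCount_eq (h : IsSymbolClassification φ t u v) {i : ℕ} (hi : i ≠ 0) :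
    CodeD.weightCount (LinearMap.range φ) i =
      #{b ∈ univ.erase (0 : V) | (Fintype.card K - 1) * u (t b) = i} := by
  unfold CodeD.weightCount
  have : {c : ι → K | c ∈ LinearMap.range φ ∧ hammingNorm c = i} =
      φ '' ({b ∈ univ.erase (0 : V) | (Fintype.card K - 1) * u (t b) = i} : Finset V) := by
    ext c
    simp only [Set.mem_ofPred_eq, LinearMap.mem_range, Set.mem_image, mem_coe, mem_filter,
      mem_erase, mem_univ, and_true]
    constructor
    · rintro ⟨⟨b, rfl⟩, hb⟩
      have hb0 : b ≠ 0 := by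
        rintro rfl
        rw [map_zero, hammingNorm_zero] at hb
        exact hi hb.symm
      exact ⟨b, ⟨hb0, by rw [← hb, h.hammingNorm_eq hb0]⟩, rfl⟩
    · rintro ⟨b, ⟨hb0, hb⟩, rfl⟩
      exact ⟨⟨b, rfl⟩, by rw [← hb, h.hammingNorm_eq hb0]⟩
  rw [this, Set.ncard_image_of_injective _ h.injective, Set.ncard_coe_finset]

theorem weightEnumerator_eq (h : IsSymbolClassification φ t u v) :
    CodeD.weightEnumerator (LinearMap.range φ) =
      1 + ∑ j, Polynomial.C (#{b ∈ univ.erase (0 : V) | t b = j} : ℤ) *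
        Polynomial.X ^ ((Fintype.card K - 1) * u j) := by
  unfold CodeD.weightEnumerator
  congr 1
  trans ∑ b ∈ univ.erase (0 : V), (Polynomial.X : Polynomial ℤ) ^ ((Fintype.card K - 1) * u (t b))
  · rw [← sum_fiberwise_of_maps_to (g := fun b => (Fintype.card K - 1) * u (t b))
      (t := Icc 1 (Fintype.card ι))]
    · refine sum_congr rfl fun i hi => ?_
      rw [h.weightCount_eq (by have := (mem_Icc.mp hi).1; omega),
        sum_congr rfl fun b hb => by rw [(mem_filter.mp hb).2]]
      simp
    · intro b hb
      exact mem_Icc.mpr ⟨h.weight_pos _, h.weight_le (ne_of_mem_erase hb)⟩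
  · rw [← sum_fiberwise (univ.erase (0 : V)) t]
    refine sum_congr rfl fun j _ => ?_
    rw [sum_congr rfl fun b hb => by rw [(mem_filter.mp hb).2]]
    simp

theorem isWeightCode (h : IsSymbolClassification φ t u v) (hu : Function.Injective u)
    (ht : ∀ j, #{b ∈ univ.erase (0 : V) | t b = j} ≠ 0) :
    CodeD.IsWeightCode (LinearMap.range φ) r := by
  unfold CodeD.IsWeightCode
  have : (Icc 1 (Fintype.card ι)).filter
      (fun i => CodeD.weightCount (LinearMap.range φ) i ≠ 0) =
      univ.image fun j => (Fintype.card K - 1) * u j := by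
    ext i
    simp only [mem_filter, mem_Icc, mem_image, mem_univ, true_and]
    constructor
    · rintro ⟨⟨hi, -⟩, hw⟩
      rw [h.weightCount_eq (by omega)] at hw
      obtain ⟨b, hb⟩ := card_ne_zero.mp hw
      exact ⟨t b, (mem_filter.mp hb).2⟩
    · rintro ⟨j, rfl⟩
      obtain ⟨b, hb⟩ := card_ne_zero.mp (ht j)
      obtain ⟨hb0, rfl⟩ := mem_filter.mp hb
      refine ⟨⟨h.weight_pos _, h.weight_le (ne_of_mem_erase hb0)⟩, ?_⟩
      rw [h.weightCount_eq (h.weight_pos _).ne']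
      exact card_ne_zero_of_mem (mem_filter.mpr ⟨hb0, rfl⟩)
  rw [this, card_image_of_injective, card_univ, Fintype.card_fin]
  intro i j hij
  exact hu (Nat.eq_of_mul_eq_mul_left (Nat.sub_pos_of_lt Fintype.one_lt_card) hij)

theorem completeWeightEnumerator_eq (h : IsSymbolClassification φ t u v) :
    CodeD.completeWeightEnumerator (LinearMap.range φ) =
      MvPolynomial.X 0 ^ Fintype.card ι +
        ∑ j, MvPolynomial.C (#{b ∈ univ.erase (0 : V) | t b = j} : ℤ) *
          (MvPolynomial.X 0 ^ v j * ∏ ρ ∈ univ.erase (0 : K), MvPolynomial.X ρ ^ u j) := by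
  classical
  unfold CodeD.completeWeightEnumerator
  have himg : univ.filter (fun c : ι → K => c ∈ LinearMap.range φ) = univ.image φ := by
    ext c
    simp
  have hconv := sum_image (s := univ) (g := φ) h.injective.injOn
    (f := fun c => ∏ ρ : K, (MvPolynomial.X ρ : MvPolynomial K ℤ) ^ CodeD.symbolCount c ρ)
  have key : ∑ c ∈ univ.image φ,
      ∏ ρ : K, (MvPolynomial.X ρ : MvPolynomial K ℤ) ^ CodeD.symbolCount c ρ =
      MvPolynomial.X 0 ^ Fintype.card ι +
        ∑ j, MvPolynomial.C (#{b ∈ univ.erase (0 : V) | t b = j} : ℤ) *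
          (MvPolynomial.X 0 ^ v j * ∏ ρ ∈ univ.erase (0 : K), MvPolynomial.X ρ ^ u j) := by
    rw [hconv, ← add_sum_erase _ _ (mem_univ (0 : V))]
    congr 1
    · rw [← mul_prod_erase _ _ (mem_univ (0 : K)), prod_eq_one]
      · simp [CodeD.symbolCount]
      · intro ρ hρ
        have : (0 : K) ≠ ρ := (ne_of_mem_erase hρ).symm
        simp [CodeD.symbolCount, this]
    · rw [← sum_fiberwise (univ.erase (0 : V)) t]
      refine sum_congr rfl fun j _ => ?_
      have hterm : ∀ b ∈ (univ.erase (0 : V)).filter (fun b => t b = j),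
          ∏ ρ : K, (MvPolynomial.X ρ : MvPolynomial K ℤ) ^ CodeD.symbolCount (φ b) ρ =
          MvPolynomial.X 0 ^ v j * ∏ ρ ∈ univ.erase (0 : K), MvPolynomial.X ρ ^ u j := by
        intro b hb
        obtain ⟨hb0, rfl⟩ := mem_filter.mp hb
        rw [← mul_prod_erase _ _ (mem_univ (0 : K)),
          h.symbolCount_eq b (ne_of_mem_erase hb0), if_pos rfl]
        congr 1
        refine prod_congr rfl fun ρ hρ => ?_
        rw [h.symbolCount_eq b (ne_of_mem_erase hb0), if_neg (ne_of_mem_erase hρ)]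
      rw [sum_congr rfl hterm]
      simp
  rw [← key]
  refine sum_congr ?_ fun _ _ => rfl
  rw [← himg]

end IsSymbolClassification

end CodesByClasses

/-! ### The power map on a finite field -/

section PowerMap

open Finset

theorem exists_pow_eq_of_isCyclic {G : Type*} [CommGroup G] [IsCyclic G] [Finite G] (n : ℕ) {c : G}
    (hc : c ^ (Nat.card G / (Nat.card G).gcd n) = 1) : ∃ x, x ^ n = c := by
  have hpos : 0 < Nat.card G := Nat.card_pos
  have hle : (powMonoidHom n : G →* G).range ≤
      (powMonoidHom (Nat.card G / (Nat.card G).gcd n) : G →* G).ker := by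
    rintro _ ⟨x, rfl⟩
    rw [MonoidHom.mem_ker, powMonoidHom_apply, powMonoidHom_apply, ← pow_mul,
      ← Nat.mul_div_assoc _ (Nat.gcd_dvd_left _ _), mul_comm,
      Nat.mul_div_assoc _ (Nat.gcd_dvd_right _ _), pow_mul, pow_card_eq_one', one_pow]
  have heq := Subgroup.eq_of_le_of_card_ge hle (by
    rw [IsCyclic.card_powMonoidHom_ker, IsCyclic.card_powMonoidHom_range,
      Nat.gcd_eq_right (Nat.div_dvd_of_dvd (Nat.gcd_dvd_left _ _))])
  have hmem : c ∈ (powMonoidHom n : G →* G).range := by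
    rw [heq]
    exact hc
  exact hmem

theorem card_pow_eq_of_isCyclic {G : Type*} [CommGroup G] [IsCyclic G] [Fintype G] [DecidableEq G]
    (n : ℕ) {c : G} (hc : ∃ x, x ^ n = c) : #{x : G | x ^ n = c} = (Nat.card G).gcd n := by
  rw [← IsCyclic.card_powMonoidHom_ker]
  have := MonoidHom.card_fiber_eq_of_mem_range (powMonoidHom n : G →* G) (x := c) (y := 1)
    hc ⟨1, by simp⟩
  simp only [powMonoidHom_apply] at this
  rw [this, Nat.card_eq_fintype_card, Fintype.card_subtype]
  congr 1
  ext x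
  simp [MonoidHom.mem_ker]

variable {F : Type*} [Field F] [Fintype F] [DecidableEq F]

/-- The number of solutions of a binomial equation over a finite field. -/
theorem card_pow_eq_of_ne_zero {n : ℕ} (hn : n ≠ 0) {c : F} (hc0 : c ≠ 0)
    (hc : c ^ ((Fintype.card F - 1) / (Fintype.card F - 1).gcd n) = 1) :
    #{x : F | x ^ n = c} = (Fintype.card F - 1).gcd n := by
  have hcard : Nat.card Fˣ = Fintype.card F - 1 := by
    rw [Nat.card_eq_fintype_card, Fintype.card_units]
  obtain ⟨x₀, hx₀⟩ := exists_pow_eq_of_isCyclic n (c := Units.mk0 c hc0) (by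
    rw [hcard, Units.ext_iff]
    simpa using hc)
  rw [← hcard, ← card_pow_eq_of_isCyclic n ⟨x₀, hx₀⟩]
  symm
  refine card_bij (fun x _ => (x : F)) ?_ ?_ ?_
  · intro x hx
    simp only [mem_filter, mem_univ, true_and, Units.ext_iff] at hx ⊢
    simpa using hx
  · intro x _ y _ h
    exact Units.ext h
  · intro y hy
    simp only [mem_filter, mem_univ, true_and] at hy
    have hy0 : y ≠ 0 := by
      rintro rfl
      rw [zero_pow hn] at hy
      exact hc0 hy.symm
    refine ⟨Units.mk0 y hy0, ?_, rfl⟩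
    simp only [mem_filter, mem_univ, true_and, Units.ext_iff]
    simpa using hy

/-- A set of nonzero elements defined by a condition on `x ^ n`, where `n` divides the order of the
multiplicative group, is a union of cosets of the group of `n`-th roots of unity. -/
theorem dvd_card_filter_pow {n : ℕ} (hn : n ∣ Fintype.card F - 1) (P : F → Prop)
    [DecidablePred P] : n ∣ #{x : F | x ≠ 0 ∧ P (x ^ n)} := by
  have hq : 0 < Fintype.card F - 1 := Nat.sub_pos_of_lt Fintype.one_lt_card
  have hn0 : n ≠ 0 := by
    rintro rfl
    exact hq.ne' (zero_dvd_iff.mp hn)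
  rw [card_eq_sum_card_image (fun x : F => x ^ n)]
  refine dvd_sum fun c hc => ?_
  obtain ⟨x, hx, rfl⟩ := mem_image.mp hc
  simp only [mem_filter, mem_univ, true_and] at hx
  have hset : ({y ∈ ({x : F | x ≠ 0 ∧ P (x ^ n)} : Finset F) | y ^ n = x ^ n} : Finset F) =
      ({y : F | y ^ n = x ^ n} : Finset F) := by
    ext y
    simp only [mem_filter, mem_univ, true_and, and_iff_right_iff_imp]
    intro hy
    refine ⟨?_, hy ▸ hx.2⟩
    rintro rfl
    rw [zero_pow hn0] at hy
    exact pow_ne_zero n hx.1 hy.symm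
  rw [hset, card_pow_eq_of_ne_zero hn0 (pow_ne_zero n hx.1), Nat.gcd_eq_right hn]
  rw [Nat.gcd_eq_right hn, ← pow_mul, Nat.mul_div_cancel' hn,
    FiniteField.pow_card_sub_one_eq_one _ hx.1]

end PowerMap

/-! ### Fibres of linear maps -/

section LinearFibres

open Finset

/-- Counting along the fibres of a linear map, which are cosets of its kernel. -/
theorem card_filter_eq_card_image_mul {R V W : Type*} [Ring R] [AddCommGroup V] [Module R V]
    [AddCommGroup W] [Module R W] [Fintype V] [DecidableEq W]
    (L : V →ₗ[R] W) (P : V → Prop) [DecidablePred P]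
    (hP : ∀ x y, L x = L y → P x → P y) :
    #{x | P x} = #(({x | P x} : Finset V).image L) * #{x | L x = 0} := by
  rw [card_eq_sum_card_image L, sum_const_nat]
  intro b hb
  obtain ⟨x, hx, rfl⟩ := mem_image.mp hb
  simp only [mem_filter, mem_univ, true_and] at hx
  refine card_bij' (fun y _ => y - x) (fun y _ => y + x) ?_ ?_ (by simp) (by simp)
  · intro y hy
    simp only [mem_filter, mem_univ, true_and] at hy ⊢
    rw [map_sub, hy.2, sub_self]
  · intro y hy
    simp only [mem_filter, mem_univ, true_and] at hy ⊢
    have h : L (y + x) = L x := by rw [map_add, hy, zero_add]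
    exact ⟨hP _ _ h.symm hx, h⟩

end LinearFibres

/-! ### Divisors of `p ^ e - 1` -/

section Arithmetic

open Finset

theorem odd_div_gcd_of_even_div {k e : ℕ} (hk : 0 < k) (h : Even (e / k.gcd e)) :
    Odd (k / k.gcd e) := by
  have hco := Nat.coprime_div_gcd_div_gcd (Nat.gcd_pos_of_pos_left e hk)
  rw [← Nat.not_even_iff_odd]
  intro h2
  exact absurd (Nat.eq_one_of_dvd_coprimes hco h2.two_dvd h.two_dvd) (by norm_num)

theorem gcd_two_mul_of_even_div {k e : ℕ} (hk : 0 < k) (h : Even (e / k.gcd e)) :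
    (2 * k).gcd e = 2 * k.gcd e := by
  set d := k.gcd e with hd
  have hd0 : 0 < d := Nat.gcd_pos_of_pos_left e hk
  obtain ⟨f, hf⟩ := h.two_dvd
  have hke : k = d * (k / d) := (Nat.mul_div_cancel' (Nat.gcd_dvd_left k e)).symm
  have hee : e = d * (2 * f) := by rw [← hf, Nat.mul_div_cancel' (Nat.gcd_dvd_right k e)]
  have hco : (k / d).Coprime f := by
    have := Nat.coprime_div_gcd_div_gcd hd0
    rw [← hd, hf] at this
    exact this.coprime_mul_left_right
  calc (2 * k).gcd e = (2 * d * (k / d)).gcd (2 * d * f) := by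
        rw [mul_assoc, ← hke, mul_comm 2 d, mul_assoc, ← hee]
    _ = 2 * d := by rw [Nat.gcd_mul_left, hco, mul_one]

/-- The geometric sum `1 + x + ⋯ + x ^ (n - 1)` has the parity of `n` for odd `x`. -/
theorem odd_geom_sum {x n : ℕ} (hx : Odd x) : Odd (∑ i ∈ range n, x ^ i) ↔ Odd n := by
  rw [Finset.odd_sum_iff_odd_card_odd]
  simp [hx.pow]

theorem dvd_pow_mul_add_one (p d : ℕ) {n : ℕ} (hn : Odd n) : p ^ d + 1 ∣ p ^ (d * n) + 1 := by
  simpa [pow_mul] using Odd.nat_add_dvd_pow_add_pow (p ^ d) 1 hn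

theorem sq_pow_sub_one (p d : ℕ) : p ^ (2 * d) - 1 = (p ^ d + 1) * (p ^ d - 1) := by
  rw [mul_comm 2 d, pow_mul]
  simpa using Nat.sq_sub_sq (p ^ d) 1

theorem pow_mul_sub_one (x n : ℕ) (hx : 0 < x) :
    x ^ n - 1 = (x - 1) * ∑ i ∈ range n, x ^ i := by
  obtain ⟨y, rfl⟩ : ∃ y, x = y + 1 := ⟨x - 1, by omega⟩
  rw [← geom_sum_mul_add, Nat.add_sub_cancel, Nat.add_sub_cancel, mul_comm]

theorem pow_sub_one_div {p d : ℕ} (hp : p ≠ 0) (hd : d ≠ 0) (hp1 : p ≠ 1) (s : ℕ) :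
    (p ^ (2 * (d * s)) - 1) / (p ^ (2 * d) - 1) = ∑ i ∈ range s, (p ^ (2 * d)) ^ i ∧
    (p ^ (2 * (d * s)) - 1) / (p ^ d + 1) =
      (p ^ d - 1) * ∑ i ∈ range s, (p ^ (2 * d)) ^ i ∧
    p ^ d + 1 ∣ p ^ (2 * (d * s)) - 1 := by
  have h1 : 0 < p ^ (2 * d) - 1 := Nat.sub_pos_of_lt (Nat.one_lt_pow (by omega) (by omega))
  have h : p ^ (2 * (d * s)) - 1 = (p ^ (2 * d) - 1) * ∑ i ∈ range s, (p ^ (2 * d)) ^ i := by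
    rw [← pow_mul_sub_one _ _ (by positivity), ← pow_mul, mul_assoc]
  have h' := h
  rw [sq_pow_sub_one p d, mul_assoc] at h'
  refine ⟨?_, ?_, Dvd.intro _ h'.symm⟩
  · rw [h, Nat.mul_div_cancel_left _ h1]
  · rw [h', Nat.mul_div_cancel_left _ (by positivity)]

end Arithmetic

/-! ### The quadratic form `Tr (a x ^ (p ^ k + 1))` -/

section TraceForm

open Finset

variable {p : ℕ} [Fact p.Prime] {F : Type*} [Field F] [Fintype F] [Algebra (ZMod p) F]

theorem trace_pow_char_pow (k : ℕ) (z : F) :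
    Algebra.trace (ZMod p) F (z ^ p ^ k) = Algebra.trace (ZMod p) F z := by
  have : ((FiniteField.frobeniusAlgEquivOfAlgebraic (ZMod p) F) ^ k) z = z ^ p ^ k := by
    rw [AlgEquiv.coe_pow, FiniteField.coe_frobeniusAlgEquivOfAlgebraic_iterate, ZMod.card]
  rw [← this, Algebra.trace_eq_of_algEquiv]

theorem exists_pow_char_pow_eq (k : ℕ) (y : F) : ∃ x : F, x ^ p ^ k = y := by
  obtain ⟨x, hx⟩ := ((FiniteField.frobeniusAlgEquivOfAlgebraic (ZMod p) F) ^ k).surjective y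
  refine ⟨x, ?_⟩
  rw [← hx, AlgEquiv.coe_pow, FiniteField.coe_frobeniusAlgEquivOfAlgebraic_iterate, ZMod.card]

variable (p) in
/-- The bilinear form `(x, y) ↦ Tr (a x ^ (p ^ k) y)`, whose quadratic form is
`x ↦ Tr (a x ^ (p ^ k + 1))`. -/
noncomputable def traceBilin (k : ℕ) (a : F) : LinearMap.BilinForm (ZMod p) F :=
  (Algebra.traceForm (ZMod p) F).compLeft
    (LinearMap.mulLeft (ZMod p) a ∘ₗ
      ((FiniteField.frobeniusAlgEquivOfAlgebraic (ZMod p) F) ^ k).toLinearMap)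

theorem traceBilin_apply (k : ℕ) (a x y : F) :
    traceBilin p k a x y = Algebra.trace (ZMod p) F (a * x ^ p ^ k * y) := by
  have : ((FiniteField.frobeniusAlgEquivOfAlgebraic (ZMod p) F) ^ k) x = x ^ p ^ k := by
    rw [AlgEquiv.coe_pow, FiniteField.coe_frobeniusAlgEquivOfAlgebraic_iterate, ZMod.card]
  simp only [traceBilin, LinearMap.BilinForm.compLeft_apply, LinearMap.comp_apply,
    AlgEquiv.toLinearMap_apply, this, LinearMap.mulLeft_apply, Algebra.traceForm_apply]

theorem traceBilin_self (k : ℕ) (a x : F) :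
    traceBilin p k a x x = Algebra.trace (ZMod p) F (a * x ^ (p ^ k + 1)) := by
  rw [traceBilin_apply, pow_succ, mul_assoc]

theorem trace_mul_eq_zero_iff (b : F) :
    (∀ y, Algebra.trace (ZMod p) F (b * y) = 0) ↔ b = 0 := by
  constructor
  · intro h
    exact (traceForm_nondegenerate (ZMod p) F).1 b h
  · rintro rfl y
    simp

theorem polar_traceBilin_eq_zero_iff (k : ℕ) (a w : F) :
    (traceBilin p k a + (traceBilin p k a).flip) w = 0 ↔
      a ^ p ^ k * w ^ p ^ (2 * k) + a * w = 0 := by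
  have h : ∀ y, (traceBilin p k a + (traceBilin p k a).flip) w y =
      Algebra.trace (ZMod p) F ((a ^ p ^ k * w ^ p ^ (2 * k) + a * w) * y ^ p ^ k) := by
    intro y
    rw [LinearMap.add_apply, LinearMap.add_apply, LinearMap.BilinForm.flip_apply, traceBilin_apply,
      traceBilin_apply, ← trace_pow_char_pow k (a * w ^ p ^ k * y), ← map_add]
    congr 1
    rw [mul_pow, mul_pow, ← pow_mul, ← pow_add, two_mul]
    ring
  rw [LinearMap.ext_iff, ← trace_mul_eq_zero_iff (p := p)]
  constructor
  · intro h0 y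
    obtain ⟨x, rfl⟩ := exists_pow_char_pow_eq (p := p) k y
    rw [← h, h0, LinearMap.zero_apply]
  · intro h0 y
    rw [h, h0, LinearMap.zero_apply]

end TraceForm

/-! ### The radical and the character sum of the trace form -/

section TraceFormSums

open Finset

variable {p : ℕ} [Fact p.Prime] {F : Type*} [Field F] [Fintype F] [Algebra (ZMod p) F]
  {d n s k e m : ℕ} {a : F}

/-- The radical of the polar form consists of `0` and the solutions of a binomial equation, which
is solvable under the condition on `a`. -/
theorem card_radical_traceBilin [DecidablePred fun w : F =>
      (traceBilin p k a + (traceBilin p k a).flip) w = 0]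
    (hp : Odd p) (hd : d ≠ 0) (hn : Odd n) (hk : k = d * n) (he : e = 2 * (d * s))
    (hgcd : (2 * k).gcd e = 2 * d) (hF : Fintype.card F = p ^ e) (ha : a ≠ 0)
    (has : a ^ ((p ^ e - 1) / (p ^ d + 1)) = (-1) ^ s) :
    #{w : F | (traceBilin p k a + (traceBilin p k a).flip) w = 0} = p ^ (2 * d) := by
  classical
  have hpp : p.Prime := Fact.out
  obtain ⟨hM, hM', -⟩ := pow_sub_one_div hpp.ne_zero hd hpp.ne_one s
  set M := ∑ i ∈ range s, (p ^ (2 * d)) ^ i with hMdef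
  rw [← he] at hM hM'
  have hk0 : 2 * k ≠ 0 := by
    rw [hk]
    have := hn.pos
    positivity
  have hgcd' : (p ^ e - 1).gcd (p ^ (2 * k) - 1) = p ^ (2 * d) - 1 := by
    rw [Nat.pow_sub_one_gcd_pow_sub_one, Nat.gcd_comm, hgcd]
  set c : F := -(a ^ (p ^ k - 1))⁻¹ with hc
  have hc0 : c ≠ 0 := neg_ne_zero.mpr (inv_ne_zero (pow_ne_zero _ ha))
  have hMs : Odd M ↔ Odd s := odd_geom_sum hp.pow
  have haM : a ^ ((p ^ k - 1) * M) = (-1) ^ s := by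
    have h1 : (p ^ k - 1) * M = (p ^ e - 1) / (p ^ d + 1) * ∑ i ∈ range n, (p ^ d) ^ i := by
      rw [hM', hk, pow_mul, pow_mul_sub_one _ _ (pow_pos hpp.pos d)]
      ring
    have hG : Odd (∑ i ∈ range n, (p ^ d) ^ i) := (odd_geom_sum hp.pow).mpr hn
    rw [h1, pow_mul, has, ← pow_mul, mul_comm, pow_mul, hG.neg_one_pow]
  have hcM : c ^ ((Fintype.card F - 1) / (Fintype.card F - 1).gcd (p ^ (2 * k) - 1)) = 1 := by
    rw [hF, hgcd', hM, hc, neg_pow, inv_pow, ← pow_mul, haM]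
    rcases Nat.even_or_odd s with h | h
    · have : Even M := by
        rw [← Nat.not_odd_iff_even, hMs, Nat.not_odd_iff_even]
        exact h
      simp [h.neg_one_pow, this.neg_one_pow]
    · simp [h.neg_one_pow, (hMs.mpr h).neg_one_pow]
  have hn0 : p ^ (2 * k) - 1 ≠ 0 := (Nat.sub_pos_of_lt (Nat.one_lt_pow hk0 hpp.one_lt)).ne'
  have hcount := card_pow_eq_of_ne_zero hn0 hc0 hcM
  rw [hF, hgcd'] at hcount
  have hset : ({w : F | (traceBilin p k a + (traceBilin p k a).flip) w = 0} : Finset F) =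
      insert 0 ({w : F | w ^ (p ^ (2 * k) - 1) = c} : Finset F) := by
    ext w
    simp only [mem_filter, mem_univ, true_and, mem_insert, polar_traceBilin_eq_zero_iff]
    by_cases hw : w = 0
    · simp [hw, hpp.ne_zero]
    · simp only [hw, false_or]
      have h1 : a ^ p ^ k = a ^ (p ^ k - 1) * a := by
        rw [← pow_succ, Nat.sub_add_cancel (Nat.one_le_pow _ _ hpp.pos)]
      have h2 : w ^ p ^ (2 * k) = w ^ (p ^ (2 * k) - 1) * w := by
        rw [← pow_succ, Nat.sub_add_cancel (Nat.one_le_pow _ _ hpp.pos)]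
      have hA : a ^ (p ^ k - 1) ≠ 0 := pow_ne_zero _ ha
      rw [h1, h2, hc]
      have h3 : a ^ (p ^ k - 1) * a * (w ^ (p ^ (2 * k) - 1) * w) + a * w =
          (a * w) * (a ^ (p ^ k - 1) * w ^ (p ^ (2 * k) - 1) + 1) := by ring
      have h4 : a ^ (p ^ k - 1) * w ^ (p ^ (2 * k) - 1) + 1 =
          a ^ (p ^ k - 1) * (w ^ (p ^ (2 * k) - 1) + (a ^ (p ^ k - 1))⁻¹) := by
        rw [mul_add, mul_inv_cancel₀ hA]
      rw [h3, mul_eq_zero, or_iff_right (mul_ne_zero ha hw), h4, mul_eq_zero, or_iff_right hA,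
        eq_neg_iff_add_eq_zero]
  rw [hset, card_insert_of_notMem, hcount, Nat.sub_add_cancel (Nat.one_le_pow _ _ hpp.pos)]
  simp only [mem_filter, mem_univ, true_and, zero_pow hn0]
  exact hc0.symm

/-- Every nonzero element of the prime field is a `(p ^ k + 1)`-th power: it is a
`(p ^ d + 1)`-th power of some `z` in the field with `p ^ (2 * d)` elements, where
`z ^ p ^ k = z ^ p ^ d`. -/
theorem exists_pow_eq_algebraMap (hd : d ≠ 0) (hn : Odd n) (hk : k = d * n)
    (he : e = 2 * (d * s)) (hF : Fintype.card F = p ^ e) {y : ZMod p} (hy : y ≠ 0) :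
    ∃ z : F, z ≠ 0 ∧ z ^ (p ^ k + 1) = algebraMap (ZMod p) F y := by
  classical
  have hpp : p.Prime := Fact.out
  obtain ⟨-, hM', hdvd⟩ := pow_sub_one_div hpp.ne_zero hd hpp.ne_one s
  rw [← he] at hM' hdvd
  have hy0 : algebraMap (ZMod p) F y ≠ 0 := (map_ne_zero _).mpr hy
  have hyd : algebraMap (ZMod p) F y ^ (p ^ d - 1) = 1 := by
    rw [pow_mul_sub_one _ _ hpp.pos, pow_mul, ← map_pow, ZMod.pow_card_sub_one_eq_one hy,
      map_one, one_pow]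
  have hcount := card_pow_eq_of_ne_zero (n := p ^ d + 1) (by positivity) hy0 (by
    rw [hF, Nat.gcd_eq_right hdvd, hM', pow_mul, hyd, one_pow])
  rw [hF, Nat.gcd_eq_right hdvd] at hcount
  obtain ⟨z, hz⟩ := card_ne_zero.mp (hcount.trans_ne (by positivity))
  simp only [mem_filter, mem_univ, true_and] at hz
  have hz0 : z ≠ 0 := by
    rintro rfl
    rw [zero_pow (by positivity)] at hz
    exact hy0 hz.symm
  refine ⟨z, hz0, ?_⟩
  have hz2 : z ^ p ^ (2 * d) = z := by
    have : z ^ (p ^ (2 * d) - 1) = 1 := by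
      rw [sq_pow_sub_one, pow_mul, hz, hyd]
    rw [← Nat.sub_add_cancel (Nat.one_le_pow (2 * d) _ hpp.pos), pow_succ, this, one_mul]
  have hzj : ∀ j, z ^ (p ^ (2 * d)) ^ j = z := by
    intro j
    induction j with
    | zero => simp
    | succ j ih => rw [pow_succ, pow_mul, ih, hz2]
  obtain ⟨j, rfl⟩ := hn
  have hkk : p ^ k = (p ^ (2 * d)) ^ j * p ^ d := by
    rw [hk, ← pow_mul, ← pow_add]
    congr 1
    ring
  rw [pow_succ, hkk, pow_mul, hzj, ← pow_succ, hz]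

/-- The quadratic form `Tr (a x ^ (p ^ k + 1))` takes all nonzero values equally often, and its
character sum is `-(-1) ^ s * p ^ (m + d)`: its absolute value comes from the order of the radical,
and its sign from its residue modulo `p ^ d + 1`. -/
theorem quadSum_traceBilin (hp : Odd p) (hd : d ≠ 0) (hn : Odd n) (hk : k = d * n)
    (hm : m = d * s) (he : e = 2 * m) (hgcd : (2 * k).gcd e = 2 * d)
    (hF : Fintype.card F = p ^ e) (ha : a ≠ 0)
    (has : a ^ ((p ^ e - 1) / (p ^ d + 1)) = (-1) ^ s) {ψ : AddChar (ZMod p) ℂ} (hψ : ψ ≠ 1)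
    {y : ZMod p} (hy : y ≠ 0) :
    ∑ x, ψ (y * traceBilin p k a x x) = ((-(-1) ^ s * (p : ℤ) ^ (m + d) : ℤ) : ℂ) := by
  classical
  have hpp : p.Prime := Fact.out
  subst hm
  have hscale : ∀ y : ZMod p, y ≠ 0 → ∃ z : F, z ≠ 0 ∧
      ∀ x, traceBilin p k a (z * x) (z * x) = y * traceBilin p k a x x := by
    intro y hy
    obtain ⟨z, hz0, hz⟩ := exists_pow_eq_algebraMap hd hn hk he hF hy
    refine ⟨z, hz0, fun x => ?_⟩
    rw [traceBilin_self, traceBilin_self, mul_pow, hz, mul_left_comm, ← Algebra.smul_def, map_smul,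
      smul_eq_mul]
  have hval : ∀ c : ZMod p, c ≠ 0 →
      #{x : F | traceBilin p k a x x = c} = #{x : F | traceBilin p k a x x = 1} := by
    intro c hc
    obtain ⟨z, hz0, hz⟩ := hscale c hc
    symm
    refine card_equiv (Equiv.mulLeft₀ z hz0) fun x => ?_
    simp [hz, hc]
  have hinv : ∀ y : ZMod p, y ≠ 0 →
      ∑ x, ψ (y * traceBilin p k a x x) = ∑ x, ψ (traceBilin p k a x x) := by
    intro y hy
    obtain ⟨z, hz0, hz⟩ := hscale y hy
    exact Fintype.sum_equiv (Equiv.mulLeft₀ z hz0) _ _ fun x => by simp [hz]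
  rw [hinv y hy, sum_addChar_comp hψ _ hval]
  congr 1
  set N₀ := #{x : F | traceBilin p k a x x = 0}
  set N₁ := #{x : F | traceBilin p k a x x = 1}
  have h2 : (2 : ZMod p) ≠ 0 := by
    have := ZMod.prime_ne_zero p 2 (by rintro rfl; exact absurd hp (by decide))
    exact_mod_cast this
  have hsq : ((N₀ : ℤ) - N₁) ^ 2 = ((p : ℤ) ^ (d * s + d)) ^ 2 := by
    have h := quadSum_mul_self hψ h2 (traceBilin p k a)
    have hneg := hinv (-1) (neg_ne_zero.mpr one_ne_zero)
    simp only [neg_mul, one_mul] at hneg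
    rw [hneg, sum_addChar_comp hψ _ hval, hF,
      card_radical_traceBilin hp hd hn hk he hgcd hF ha has, he] at h
    have h' : ((N₀ : ℤ) - N₁) * (N₀ - N₁) = (p : ℤ) ^ (2 * (d * s)) * p ^ (2 * d) := by
      exact_mod_cast h
    rw [sq, h']
    ring
  -- Both counts are known modulo `p ^ d + 1`, because `x ^ (p ^ k + 1)` only depends on
  -- `x ^ (p ^ d + 1)`.
  obtain ⟨-, -, hdvd⟩ := pow_sub_one_div hpp.ne_zero hd hpp.ne_one s
  obtain ⟨t, ht⟩ := dvd_pow_mul_add_one p d hn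
  rw [← hk] at ht
  have hcong : ∀ c : ZMod p,
      p ^ d + 1 ∣ #{x : F | x ≠ 0 ∧ traceBilin p k a x x = c} := by
    intro c
    have h := dvd_card_filter_pow (F := F) (n := p ^ d + 1) (by rwa [hF, he])
      (fun u => Algebra.trace (ZMod p) F (a * u ^ t) = c)
    simpa only [← pow_mul, ← ht, ← traceBilin_self] using h
  have hN₁ : p ^ d + 1 ∣ N₁ := by
    have h : N₁ = #{x : F | x ≠ 0 ∧ traceBilin p k a x x = 1} := by
      refine congr_arg card (Finset.ext fun x => ?_)
      simp only [mem_filter, mem_univ, true_and, iff_and_self]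
      rintro h rfl
      simp at h
    exact h ▸ hcong 1
  have hN₀ : ∃ r : ℕ, N₀ = (p ^ d + 1) * r + 1 := by
    obtain ⟨r, hr⟩ := hcong 0
    refine ⟨r, ?_⟩
    rw [← hr, ← card_insert_of_notMem (a := (0 : F)) (by simp)]
    refine congr_arg card (Finset.ext fun x => ?_)
    by_cases hx : x = 0 <;> simp [hx]
  obtain ⟨r₁, hr₁⟩ := hN₁
  obtain ⟨r₀, hr₀⟩ := hN₀
  have hpow : ((p : ℤ) ^ d + 1) ∣ (p : ℤ) ^ (d * s + d) - (-1) ^ (s + 1) := by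
    have := sub_dvd_pow_sub_pow ((p : ℤ) ^ d) (-1) (s + 1)
    rwa [sub_neg_eq_add, ← pow_mul, mul_add, mul_one] at this
  obtain ⟨r₂, hr₂⟩ := hpow
  have hS1 : (N₀ : ℤ) - N₁ = (p ^ d + 1) * (r₀ - r₁) + 1 := by
    rw [hr₀, hr₁]
    push_cast
    ring
  have hsign : ((-1 : ℤ) ^ s) * (-1) ^ s = 1 := by
    rw [← mul_pow]
    simp
  have hpd : 3 ≤ (p : ℤ) ^ d := by
    have h3 : 3 ≤ p := by
      have := hpp.two_le
      rcases hp with ⟨j, rfl⟩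
      omega
    calc (3 : ℤ) ≤ p := by exact_mod_cast h3
      _ ≤ (p : ℤ) ^ d := le_self_pow₀ (by omega) hd
  have hbad : (N₀ : ℤ) - N₁ ≠ (-1) ^ s * (p : ℤ) ^ (d * s + d) := by
    intro h
    have hdiv : (p : ℤ) ^ d + 1 ∣ 2 := by
      refine ⟨(-1) ^ s * r₂ - (r₀ - r₁), ?_⟩
      rw [h] at hS1
      rw [pow_succ] at hr₂
      linear_combination (-1 : ℤ) ^ s * hr₂ - hS1 - hsign
    have := Int.le_of_dvd (by norm_num) hdiv
    omega
  rcases sq_eq_sq_iff_eq_or_eq_neg.mp hsq with h | h <;>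
    rcases neg_one_pow_eq_or ℤ s with h' | h' <;> rw [h'] at hbad ⊢ <;> simp_all

end TraceFormSums

/-! ### Classes of messages of the trace code -/

section TraceCode

open Finset

variable {p : ℕ} [Fact p.Prime] {F : Type*} [Field F] [Algebra (ZMod p) F]

variable (p) in
/-- The encoding map `b ↦ (Tr (b x))_{x ∈ D}`. -/
noncomputable def traceEncode (D : Finset F) : F →ₗ[ZMod p] D → ZMod p :=
  LinearMap.pi fun x : D =>
    (Algebra.trace (ZMod p) F).comp (LinearMap.mulRight (ZMod p) (x : F))

theorem traceEncode_apply (D : Finset F) (b : F) (x : D) :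
    traceEncode p D b x = Algebra.trace (ZMod p) F (b * x) := rfl

variable [Fintype F]

variable (p) in
/-- The polar form of `Tr (a x ^ (p ^ k + 1))` as an endomorphism of the field, functionals being
represented through the trace form. -/
noncomputable def polarEnd (k : ℕ) (a : F) : F →ₗ[ZMod p] F :=
  ((Algebra.traceForm (ZMod p) F).toDual (traceForm_nondegenerate (ZMod p) F)).symm.toLinearMap ∘ₗ
    (traceBilin p k a + (traceBilin p k a).flip)

theorem polarEnd_eq_iff (k : ℕ) (a w b : F) :
    polarEnd p k a w = b ↔
      (traceBilin p k a + (traceBilin p k a).flip) w = Algebra.traceForm (ZMod p) F b := by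
  unfold polarEnd
  rw [LinearMap.comp_apply, LinearEquiv.coe_coe, LinearEquiv.symm_apply_eq]
  rfl

open Classical in
variable (p) in
/-- The class of a message `b`: `0` if the functional `Tr (b x)` is not polar, otherwise `1` or `2`
according as it is polar to singular or to nonsingular vectors. -/
noncomputable def polarClass (k : ℕ) (a b : F) : Fin 3 :=
  if b ∈ ({w : F | traceBilin p k a w w = 0} : Finset F).image (polarEnd p k a) then 1
  else if b ∈ (univ : Finset F).image (polarEnd p k a) then 2 else 0

theorem quad_eq_of_polarEnd_eq (hp : Odd p) (k : ℕ) (a : F) {w w' : F}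
    (h : polarEnd p k a w = polarEnd p k a w') :
    traceBilin p k a w w = traceBilin p k a w' w' := by
  have h2 : (2 : ZMod p) ≠ 0 := by
    have := ZMod.prime_ne_zero p 2 (by rintro rfl; exact absurd hp (by decide))
    exact_mod_cast this
  apply quad_eq_of_polar_eq h2
  rw [polarEnd_eq_iff] at h
  rw [h, eq_comm, ← polarEnd_eq_iff]

open Classical in
/-- The numbers of messages in the three classes, in terms of the number of singular vectors and
the order of the radical. -/
theorem card_polarClass (hp : Odd p) (k : ℕ) (a : F) :
    ∃ I₀ I : ℕ,
      #{w : F | traceBilin p k a w w = 0} =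
        I₀ * #{w : F | (traceBilin p k a + (traceBilin p k a).flip) w = 0} ∧
      Fintype.card F =
        I * #{w : F | (traceBilin p k a + (traceBilin p k a).flip) w = 0} ∧
      (#{b ∈ univ.erase (0 : F) | polarClass p k a b = 0} : ℤ) = Fintype.card F - I ∧
      (#{b ∈ univ.erase (0 : F) | polarClass p k a b = 1} : ℤ) = I₀ - 1 ∧
      (#{b ∈ univ.erase (0 : F) | polarClass p k a b = 2} : ℤ) = I - I₀ := by
  set A := ({w : F | traceBilin p k a w w = 0} : Finset F).image (polarEnd p k a) with hA
  set B := (univ : Finset F).image (polarEnd p k a) with hB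
  have hAB : A ⊆ B := image_subset_image (filter_subset _ _)
  have h0A : (0 : F) ∈ A := mem_image.mpr ⟨0, by simp, by simp⟩
  have hker : #{w : F | polarEnd p k a w = 0} =
      #{w : F | (traceBilin p k a + (traceBilin p k a).flip) w = 0} := by
    congr 1
    ext w
    simp only [mem_filter, mem_univ, true_and]
    rw [polarEnd_eq_iff, map_zero]
  refine ⟨#A, #B, ?_, ?_, ?_, ?_, ?_⟩
  · rw [← hker]
    exact card_filter_eq_card_image_mul (polarEnd p k a) _ fun x y h hx =>
      (quad_eq_of_polarEnd_eq hp k a h).symm.trans hx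
  · rw [← hker]
    have := card_filter_eq_card_image_mul (polarEnd p k a) (fun _ => True) (by simp)
    simpa using this
  · rw [← Nat.cast_sub (card_le_univ B), ← card_univ_sdiff B]
    congr 2
    ext b
    have h1 : b ∈ A → b ∈ B := fun h => hAB h
    have h2 : b = 0 → b ∈ B := fun h => h ▸ hAB h0A
    simp only [polarClass, ← hA, ← hB, mem_filter, mem_erase, mem_univ, and_true, mem_sdiff,
      true_and]
    split_ifs with h h'
    · simp [h1 h]
    · simp [h']
    · simp only [h', not_false_eq_true, and_true, iff_true]
      exact fun h0 => h' (h2 h0)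
  · have : #(A.erase 0) + 1 = #A := card_erase_add_one h0A
    rw [← this, Nat.cast_add, Nat.cast_one, add_sub_cancel_right]
    congr 2
    ext b
    simp only [polarClass, ← hA, ← hB, mem_filter, mem_erase, mem_univ, and_true]
    split_ifs with h h' <;> simp [h]
  · rw [← Nat.cast_sub (card_le_card hAB), ← card_sdiff_of_subset hAB]
    congr 2
    ext b
    have h2 : b = 0 → b ∈ A := fun h => h ▸ h0A
    simp only [polarClass, ← hA, ← hB, mem_filter, mem_erase, mem_univ, and_true, mem_sdiff]
    split_ifs with h h'
    · simp [h]
    · simp only [h, h', not_false_eq_true, and_true, iff_true]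
      exact fun h0 => h (h2 h0)
    · simp [h']

/-- The origin is a zero of the quadratic form that does not belong to the defining set. -/
theorem symbolCount_traceEncode (k : ℕ) (a b : F) (ρ : ZMod p) :
    CodeD.symbolCount (traceEncode p (CodeD.definingSet p k a 0) b) ρ + (if ρ = 0 then 1 else 0) =
      #{x : F | traceBilin p k a x x = 0 ∧ Algebra.traceForm (ZMod p) F b x = ρ} := by
  classical
  have h1 : CodeD.symbolCount (traceEncode p (CodeD.definingSet p k a 0) b) ρ =
      #{x ∈ ({x : F | traceBilin p k a x x = 0 ∧ Algebra.traceForm (ZMod p) F b x = ρ} : Finset F) |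
        x ≠ 0} := by
    unfold CodeD.symbolCount
    refine card_bij (fun x _ => (x : F)) ?_ (fun x _ y _ h => Subtype.ext h) ?_
    · rintro ⟨x, hx⟩ h
      simp only [CodeD.definingSet, mem_filter, mem_univ, true_and] at hx
      replace h := (mem_filter.mp h).2
      rw [traceEncode_apply] at h
      simp only [mem_filter, mem_univ, true_and, traceBilin_self, Algebra.traceForm_apply]
      exact ⟨⟨hx.2, h⟩, hx.1⟩
    · intro x hx
      simp only [mem_filter, mem_univ, true_and, traceBilin_self, Algebra.traceForm_apply] at hx
      refine ⟨⟨x, ?_⟩, ?_, rfl⟩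
      · simp only [CodeD.definingSet, mem_filter, mem_univ, true_and]
        exact ⟨hx.2, hx.1.1⟩
      · refine mem_filter.mpr ⟨mem_univ _, ?_⟩
        rw [traceEncode_apply]
        exact hx.1.2
  rw [h1, ← card_filter_add_card_filter_not (s :=
    ({x : F | traceBilin p k a x x = 0 ∧ Algebra.traceForm (ZMod p) F b x = ρ} : Finset F))
    (fun x => x ≠ 0)]
  congr 1
  split_ifs with hρ
  · symm
    rw [card_eq_one]
    refine ⟨0, ?_⟩
    ext x
    simp only [mem_filter, mem_univ, true_and, not_not, mem_singleton, and_iff_right_iff_imp]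
    rintro rfl
    simp [hρ]
  · symm
    rw [card_eq_zero, filter_eq_empty_iff]
    intro x hx hx0
    rw [not_not] at hx0
    simp only [mem_filter, mem_univ, true_and] at hx
    rw [hx0, map_zero, map_zero] at hx
    exact hρ hx.2.symm

theorem card_definingSet [DecidableEq F] (k : ℕ) (a : F) :
    #(CodeD.definingSet p k a 0) + 1 = #{x : F | traceBilin p k a x x = 0} := by
  rw [← card_insert_of_notMem (a := (0 : F)) (by simp [CodeD.definingSet])]
  congr 1
  ext x
  by_cases hx : x = 0 <;> simp [hx, CodeD.definingSet, traceBilin_self]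

/-- The symbol distribution of the words of the trace code in terms of the common value `S` of the
character sums of the multiples of the quadratic form. -/
theorem isSymbolClassification_traceEncode {k : ℕ} {a : F} {S : ℤ} (hS0 : S ≠ 0)
    {ψ : AddChar (ZMod p) ℂ} (hψ : ψ ≠ 1)
    (hS : ∀ y : ZMod p, y ≠ 0 → ∑ x, ψ (y * traceBilin p k a x x) = S) {u v : Fin 3 → ℕ}
    (hpos : ∀ j, 0 < u j)
    (hu0 : (p : ℤ) ^ 2 * u 0 = Fintype.card F + (p - 1) * S)
    (hv0 : (p : ℤ) ^ 2 * (v 0 + 1) = Fintype.card F + (p - 1) * S)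
    (hu1 : (p : ℤ) ^ 2 * u 1 = Fintype.card F)
    (hv1 : (p : ℤ) ^ 2 * (v 1 + 1) = Fintype.card F + p * (p - 1) * S)
    (hu2 : (p : ℤ) ^ 2 * u 2 = Fintype.card F + p * S)
    (hv2 : (p : ℤ) ^ 2 * (v 2 + 1) = Fintype.card F) :
    IsSymbolClassification (traceEncode p (CodeD.definingSet p k a 0)) (polarClass p k a) u v where
  pos := hpos
  symbolCount_eq b hb ρ := by
    classical
    have hp2 : (p : ℤ) ^ 2 ≠ 0 := by
      have := (Fact.out : p.Prime).ne_zero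
      positivity
    have hsc := symbolCount_traceEncode (p := p) k a b ρ
    rw [← Nat.cast_inj (R := ℤ), ← mul_right_inj' hp2] at hsc ⊢
    push_cast at hsc ⊢
    have hℓ0 : Algebra.traceForm (ZMod p) F b ≠ 0 := by
      intro h
      exact hb ((traceForm_nondegenerate (ZMod p) F).1 b (fun y => by rw [h, LinearMap.zero_apply]))
    by_cases hA : b ∈ ({w : F | traceBilin p k a w w = 0} : Finset F).image (polarEnd p k a)
    · rw [show polarClass p k a b = 1 from if_pos hA]
      obtain ⟨w, hw, hwb⟩ := mem_image.mp hA
      rw [polarEnd_eq_iff] at hwb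
      have h := card_zeros_of_polar_isotropic hψ _ hS (hwb ▸ hℓ0) (mem_filter.mp hw).2 ρ
      rw [ZMod.card, hwb, ← hsc] at h
      split_ifs at h ⊢
      · linear_combination h - hv1
      · linear_combination h - hu1
    by_cases hB : b ∈ (univ : Finset F).image (polarEnd p k a)
    · rw [show polarClass p k a b = 2 from (if_neg hA).trans (if_pos hB)]
      obtain ⟨w, -, hwb⟩ := mem_image.mp hB
      have hQ : traceBilin p k a w w ≠ 0 := fun h =>
        hA (mem_image.mpr ⟨w, by simpa using h, hwb⟩)
      rw [polarEnd_eq_iff] at hwb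
      have h := card_zeros_of_polar_anisotropic hψ _ hS (hwb ▸ hℓ0) hQ ρ
      rw [ZMod.card, hwb, ← hsc] at h
      split_ifs at h ⊢
      · linear_combination h - hv2
      · linear_combination h - hu2
    · rw [show polarClass p k a b = 0 from (if_neg hA).trans (if_neg hB)]
      have h := card_zeros_of_not_polar hψ _ hS hS0 (ℓ := Algebra.traceForm (ZMod p) F b)
        (fun w hw => hB (mem_image.mpr ⟨w, mem_univ w, (polarEnd_eq_iff k a w b).mpr hw⟩)) ρ
      rw [ZMod.card, ← hsc] at h
      split_ifs at h ⊢
      · linear_combination h - hv0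
      · linear_combination h - hu0

end TraceCode

/-! ### The parameters of the trace code -/

section Distribution

open Finset

variable {p : ℕ} [Fact p.Prime] {F : Type*} [Field F] [Fintype F] [Algebra (ZMod p) F]

theorem injective_vec3 {α : Type*} {x y z : α} (hxy : x ≠ y) (hyz : y ≠ z) (hxz : x ≠ z) :
    Function.Injective ![x, y, z] := by
  intro j j' h
  fin_cases j <;> fin_cases j' <;>
    first
    | rfl
    | exact absurd h hxy
    | exact absurd h hyz
    | exact absurd h hxz
    | exact absurd h.symm hxy
    | exact absurd h.symm hyz
    | exact absurd h.symm hxz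

/-- The numbers of components of each kind in the words of the three classes are nonnegative, and
the numbers of components equal to a nonzero symbol are positive and distinct. Here `P`, `X`, `Y`
stand for `p`, `p ^ (2 * d + i)`, `p ^ i`. -/
theorem exists_symbolCounts {P X Y ε : ℤ} (hP : 3 ≤ P) (hX : 1 ≤ X) (hY : 1 ≤ Y)
    (hε : ε = 1 ∨ ε = -1) :
    ∃ u v : Fin 3 → ℕ, (∀ j, 0 < u j) ∧ Function.Injective u ∧
      (u 0 : ℤ) = X * Y * P ^ 2 - ε * (P - 1) * X ∧
      (v 0 : ℤ) = X * Y * P ^ 2 - ε * (P - 1) * X - 1 ∧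
      (u 1 : ℤ) = X * Y * P ^ 2 ∧
      (v 1 : ℤ) = X * Y * P ^ 2 - ε * (P - 1) * (X * P) - 1 ∧
      (u 2 : ℤ) = X * Y * P ^ 2 - ε * (X * P) ∧
      (v 2 : ℤ) = X * Y * P ^ 2 - 1 := by
  have hbd : P ^ 2 ≤ Y * P ^ 2 := le_mul_of_one_le_left (by positivity) hY
  have hP2 : 3 * P ≤ P ^ 2 := by nlinarith
  have hεP : ε * (P - 1) ≤ P - 1 := by rcases hε with h | h <;> rw [h] <;> linarith
  have hεP' : ε * P ≤ P := by rcases hε with h | h <;> rw [h] <;> linarith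
  have hεPP : ε * (P - 1) * P ≤ (P - 1) * P := mul_le_mul_of_nonneg_right hεP (by linarith)
  have hε0 : ε ≠ 0 := by rcases hε with h | h <;> rw [h] <;> norm_num
  have hX0 : X ≠ 0 := by linarith
  have hu₁0 : 0 < X * (Y * P ^ 2 - ε * (P - 1)) := mul_pos (by linarith) (by linarith)
  have hu₂0 : 0 < X * (Y * P ^ 2) := mul_pos (by linarith) (by linarith)
  have hv₂0 : 0 < X * (Y * P ^ 2 - ε * (P - 1) * P) := mul_pos (by linarith) (by linarith)
  have hu₃0 : 0 < X * (Y * P ^ 2 - ε * P) := mul_pos (by linarith) (by linarith)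
  obtain ⟨u₁, hu₁⟩ := Int.eq_ofNat_of_zero_le
    (show 0 ≤ X * Y * P ^ 2 - ε * (P - 1) * X by linarith)
  obtain ⟨v₁, hv₁⟩ := Int.eq_ofNat_of_zero_le
    (show 0 ≤ X * Y * P ^ 2 - ε * (P - 1) * X - 1 by linarith)
  obtain ⟨u₂, hu₂⟩ := Int.eq_ofNat_of_zero_le (show 0 ≤ X * Y * P ^ 2 by linarith)
  obtain ⟨v₂, hv₂⟩ := Int.eq_ofNat_of_zero_le
    (show 0 ≤ X * Y * P ^ 2 - ε * (P - 1) * (X * P) - 1 by linarith)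
  obtain ⟨u₃, hu₃⟩ := Int.eq_ofNat_of_zero_le
    (show 0 ≤ X * Y * P ^ 2 - ε * (X * P) by linarith)
  obtain ⟨v₃, hv₃⟩ := Int.eq_ofNat_of_zero_le (show 0 ≤ X * Y * P ^ 2 - 1 by linarith)
  refine ⟨![u₁, u₂, u₃], ![v₁, v₂, v₃], ?_, ?_, hu₁.symm, hv₁.symm, hu₂.symm, hv₂.symm, hu₃.symm,
    hv₃.symm⟩
  · have h1 : 0 < (u₁ : ℤ) := by linarith
    have h2 : 0 < (u₂ : ℤ) := by linarith
    have h3 : 0 < (u₃ : ℤ) := by linarith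
    rw [Nat.cast_pos] at h1 h2 h3
    intro j
    fin_cases j
    exacts [h1, h2, h3]
  · -- The differences of the three values are `ε * X` times `P - 1`, `P` and `1`, up to sign.
    refine injective_vec3 (fun h => ?_) (fun h => ?_) (fun h => ?_)
    · rw [← Nat.cast_inj (R := ℤ), ← hu₁, ← hu₂] at h
      exact mul_ne_zero (mul_ne_zero hε0 (by linarith : P - 1 ≠ 0)) hX0 (by linarith)
    · rw [← Nat.cast_inj (R := ℤ), ← hu₂, ← hu₃] at h
      exact mul_ne_zero hε0 (mul_ne_zero hX0 (by linarith : P ≠ 0)) (by linarith)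
    · rw [← Nat.cast_inj (R := ℤ), ← hu₁, ← hu₃] at h
      exact mul_ne_zero hε0 hX0 (by linarith)

/-- No class of nonzero words is empty. Here `P`, `Y`, `Z` stand for `p`, `p ^ i`, `p ^ (2 * d)`. -/
theorem multiplicities_pos {P Y Z ε : ℤ} (hP : 3 ≤ P) (hY : 1 ≤ Y) (hZ : 1 < Z)
    (hε : ε = 1 ∨ ε = -1) :
    0 < Z * Y * Y * P ^ 4 - Y ^ 2 * P ^ 4 ∧
      0 < Y ^ 2 * P ^ 3 - ε * (P - 1) * (Y * P) - 1 ∧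
      0 < (P - 1) * (Y ^ 2 * P ^ 3 + ε * (Y * P)) := by
  have hbd : P ^ 2 ≤ Y * P ^ 2 := le_mul_of_one_le_left (by positivity) hY
  have hP2 : 3 * P ≤ P ^ 2 := by nlinarith
  have hεP : ε * (P - 1) ≤ P - 1 := by rcases hε with h | h <;> rw [h] <;> linarith
  have hε1 : -1 ≤ ε := by rcases hε with rfl | rfl <;> norm_num
  have hYP : 0 < Y * P := mul_pos (by linarith) (by linarith)
  refine ⟨?_, ?_, ?_⟩
  · have : 0 < (Z - 1) * (Y ^ 2 * P ^ 4) := mul_pos (by linarith) (by positivity)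
    linarith
  · have : Y * P * 2 ≤ Y * P * (Y * P ^ 2 - ε * (P - 1)) :=
      mul_le_mul_of_nonneg_left (by linarith) hYP.le
    linarith
  · have : 0 < Y * P * (Y * P ^ 2 + ε) := mul_pos hYP (by linarith)
    exact mul_pos (by linarith) (by linarith)

open Classical in
/-- The parameters of the trace code once the radical of the quadratic form and its character sum
are known; the numbers `d` and `i` stand for `m = d + 2 + i`, and `ε` for the sign `(-1) ^ s`. -/
theorem exists_isSymbolClassification (hp : Odd p) {d i k : ℕ} (hd0 : d ≠ 0) {a : F} {ε : ℤ}
    (hε1 : ε = 1 ∨ ε = -1) (hF : Fintype.card F = p ^ (2 * d + 2 * i + 4))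
    {ψ : AddChar (ZMod p) ℂ} (hψ : ψ ≠ 1)
    (hS : ∀ y : ZMod p, y ≠ 0 → ∑ x, ψ (y * traceBilin p k a x x) =
      ((-ε * (p : ℤ) ^ (2 * d + i + 2) : ℤ) : ℂ))
    (hrad : #{w : F | (traceBilin p k a + (traceBilin p k a).flip) w = 0} = p ^ (2 * d)) :
    ∃ u v : Fin 3 → ℕ,
      IsSymbolClassification (traceEncode p (CodeD.definingSet p k a 0)) (polarClass p k a) u v ∧
      Function.Injective u ∧
      (∀ j, #{b ∈ univ.erase (0 : F) | polarClass p k a b = j} ≠ 0) ∧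
      (#(CodeD.definingSet p k a 0) : ℤ) =
        p ^ (2 * d + 2 * i + 3) - ε * (p - 1) * p ^ (2 * d + i + 1) - 1 ∧
      (u 0 : ℤ) = p ^ (2 * d + 2 * i + 2) - ε * (p - 1) * p ^ (2 * d + i) ∧
      (v 0 : ℤ) = p ^ (2 * d + 2 * i + 2) - ε * (p - 1) * p ^ (2 * d + i) - 1 ∧
      (u 1 : ℤ) = p ^ (2 * d + 2 * i + 2) ∧
      (v 1 : ℤ) = p ^ (2 * d + 2 * i + 2) - ε * (p - 1) * p ^ (2 * d + i + 1) - 1 ∧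
      (u 2 : ℤ) = p ^ (2 * d + 2 * i + 2) - ε * p ^ (2 * d + i + 1) ∧
      (v 2 : ℤ) = p ^ (2 * d + 2 * i + 2) - 1 ∧
      (#{b ∈ univ.erase (0 : F) | polarClass p k a b = 0} : ℤ) =
        p ^ (2 * d + 2 * i + 4) - p ^ (2 * i + 4) ∧
      (#{b ∈ univ.erase (0 : F) | polarClass p k a b = 1} : ℤ) =
        p ^ (2 * i + 3) - ε * (p - 1) * p ^ (i + 1) - 1 ∧
      (#{b ∈ univ.erase (0 : F) | polarClass p k a b = 2} : ℤ) =
        (p - 1) * (p ^ (2 * i + 3) + ε * p ^ (i + 1)) := by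
  have hpp : p.Prime := Fact.out
  have hp3 : 3 ≤ p := by
    have := hpp.two_le
    rcases hp with ⟨j, rfl⟩
    omega
  have hzeros := card_zeros hψ _ hS
  obtain ⟨I₀, I, hI₀, hI, hc0, hc1, hc2⟩ := card_polarClass (p := p) hp k a
  have hlen := card_definingSet (p := p) k a
  have hp3' : (3 : ℤ) ≤ p := by exact_mod_cast hp3
  have hp0 : (0 : ℤ) < p := by linarith
  have hFZ : (Fintype.card F : ℤ) = (p : ℤ) ^ (2 * d + 2 * i + 4) := by rw [hF]; push_cast; rfl
  set X : ℤ := (p : ℤ) ^ (2 * d + i) with hX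
  set Y : ℤ := (p : ℤ) ^ i with hY
  set Z : ℤ := (p : ℤ) ^ (2 * d) with hZ
  have hXYZ : X = Z * Y := pow_add _ _ _
  have hX0 : 1 ≤ X := Int.add_one_le_of_lt (pow_pos hp0 _)
  have hY0 : 1 ≤ Y := Int.add_one_le_of_lt (pow_pos hp0 _)
  have hZ1 : 1 < Z := one_lt_pow₀ (by linarith) (by omega)
  have x1 : (p : ℤ) ^ (2 * d + 2 * i + 4) = X * Y * p ^ 4 := by rw [hX, hY]; ring
  have x2 : (p : ℤ) ^ (2 * d + 2 * i + 3) = X * Y * p ^ 3 := by rw [hX, hY]; ring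
  have x3 : (p : ℤ) ^ (2 * d + 2 * i + 2) = X * Y * p ^ 2 := by rw [hX, hY]; ring
  have x4 : (p : ℤ) ^ (2 * d + i + 1) = X * p := by rw [hX]; ring
  have x5 : (p : ℤ) ^ (2 * i + 4) = Y ^ 2 * p ^ 4 := by rw [hY]; ring
  have x6 : (p : ℤ) ^ (2 * i + 3) = Y ^ 2 * p ^ 3 := by rw [hY]; ring
  have x7 : (p : ℤ) ^ (i + 1) = Y * p := by rw [hY]; ring
  have x8 : (p : ℤ) ^ (2 * d + i + 2) = X * p ^ 2 := by rw [hX]; ring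
  simp only [x1, x2, x3, x4, x5, x6, x7]
  rw [x1] at hFZ
  rw [x8] at hzeros hS
  clear_value X Y Z
  clear x1 x2 x3 x4 x5 x6 x7 x8
  rw [hrad] at hI₀ hI
  have hI₀Z : (#{x : F | traceBilin p k a x x = 0} : ℤ) = I₀ * Z := by
    rw [hI₀, hZ]; push_cast; rfl
  have hIZ : (Fintype.card F : ℤ) = I * Z := by rw [hI, hZ]; push_cast; rfl
  rw [ZMod.card] at hzeros
  have hN₀ : (#{x : F | traceBilin p k a x x = 0} : ℤ) = X * (Y * p ^ 3 - ε * (p - 1) * p) := by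
    apply mul_left_cancel₀ hp0.ne'
    rw [hzeros, hFZ]
    ring
  have hI' : (I : ℤ) = Y ^ 2 * p ^ 4 := by
    apply mul_right_cancel₀ (by linarith : Z ≠ 0)
    rw [← hIZ, hFZ, hXYZ]
    ring
  have hI₀' : (I₀ : ℤ) = Y * (Y * p ^ 3 - ε * (p - 1) * p) := by
    apply mul_right_cancel₀ (by linarith : Z ≠ 0)
    rw [← hI₀Z, hN₀, hXYZ]
    ring
  obtain ⟨u, v, hpos, hinj, hu₀, hv₀, hu₁, hv₁, hu₂, hv₂⟩ := exists_symbolCounts hp3' hX0 hY0 hε1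
  obtain ⟨hm0, hm1, hm2⟩ := multiplicities_pos hp3' hY0 hZ1 hε1
  rw [← hXYZ] at hm0
  have hε0 : ε ≠ 0 := by rcases hε1 with h | h <;> rw [h] <;> norm_num
  have hXp : X * (p : ℤ) ^ 2 ≠ 0 := mul_ne_zero (by linarith) (pow_ne_zero _ hp0.ne')
  have hcls : IsSymbolClassification (traceEncode p (CodeD.definingSet p k a 0))
      (polarClass p k a) u v :=
    isSymbolClassification_traceEncode (mul_ne_zero (neg_ne_zero.mpr hε0) hXp) hψ hS hpos
      (by rw [hFZ, hu₀]; ring) (by rw [hFZ, hv₀]; ring) (by rw [hFZ, hu₁]; ring)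
      (by rw [hFZ, hv₁]; ring) (by rw [hFZ, hu₂]; ring) (by rw [hFZ, hv₂]; ring)
  have hC0 : (#{b ∈ univ.erase (0 : F) | polarClass p k a b = 0} : ℤ) =
      X * Y * p ^ 4 - Y ^ 2 * p ^ 4 := by rw [hc0, hFZ, hI']
  have hC1 : (#{b ∈ univ.erase (0 : F) | polarClass p k a b = 1} : ℤ) =
      Y ^ 2 * p ^ 3 - ε * (p - 1) * (Y * p) - 1 := by rw [hc1, hI₀']; ring
  have hC2 : (#{b ∈ univ.erase (0 : F) | polarClass p k a b = 2} : ℤ) =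
      (p - 1) * (Y ^ 2 * p ^ 3 + ε * (Y * p)) := by rw [hc2, hI', hI₀']; ring
  refine ⟨u, v, hcls, hinj, ?_, ?_, hu₀, hv₀, hu₁, hv₁, hu₂, hv₂, hC0, hC1, hC2⟩
  · intro j
    rw [← Nat.cast_ne_zero (R := ℤ)]
    fin_cases j
    exacts [hC0.trans_ne hm0.ne', hC1.trans_ne hm1.ne', hC2.trans_ne hm2.ne']
  · have : (#(CodeD.definingSet p k a 0) : ℤ) + 1 = #{x : F | traceBilin p k a x x = 0} := by
      exact_mod_cast hlen
    rw [eq_sub_iff_add_eq.mpr this, hN₀]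
    ring

end Distribution

/-! ### The weight distribution -/

theorem theorem2 (p : ℕ) [Fact p.Prime] (hp : Odd p)
    (k e m d s : ℕ) (hk : 0 < k) (he : e = 2 * m)
    (hd : d = Nat.gcd k e) (hed : Even (e / d)) (hs : s = m / d) (hm : d + 1 < m)
    {F : Type*} [Field F] [Fintype F] [Algebra (ZMod p) F] (hF : Fintype.card F = p ^ e)
    (a : F) (ha : a ≠ 0) (has : a ^ ((p ^ e - 1) / (p ^ d + 1)) = (-1) ^ s) :
    ∃ n u₁ v₁ u₂ v₂ u₃ v₃ : ℕ,
      -- the length `n`; in the `j`-th class of nonzero codewords, `v_j` is the number of components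
      -- equal to `0` and `u_j` the number of components equal to `ρ`, for each `ρ ≠ 0`
      (n : ℤ) = p ^ (e - 1) - (-1) ^ s * (p - 1) * p ^ (m + d - 1) - 1 ∧
      (u₁ : ℤ) = p ^ (e - 2) - (-1) ^ s * (p - 1) * p ^ (m + d - 2) ∧
      (v₁ : ℤ) = p ^ (e - 2) - (-1) ^ s * (p - 1) * p ^ (m + d - 2) - 1 ∧
      (u₂ : ℤ) = p ^ (e - 2) ∧
      (v₂ : ℤ) = p ^ (e - 2) - (-1) ^ s * (p - 1) * p ^ (m + d - 1) - 1 ∧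
      (u₃ : ℤ) = p ^ (e - 2) - (-1) ^ s * p ^ (m + d - 1) ∧
      (v₃ : ℤ) = p ^ (e - 2) - 1 ∧
      CodeD.IsCodeWithParameters (CodeD.traceCode p (CodeD.definingSet p k a 0)) n e ∧
      CodeD.IsWeightCode (CodeD.traceCode p (CodeD.definingSet p k a 0)) 3 ∧
      CodeD.weightEnumerator (CodeD.traceCode p (CodeD.definingSet p k a 0)) =
        1 + Polynomial.C ((p : ℤ) ^ e - p ^ (e - 2 * d)) * Polynomial.X ^ ((p - 1) * u₁)
          + Polynomial.C ((p : ℤ) ^ (e - 2 * d - 1) - (-1) ^ s * (p - 1) * p ^ (m - d - 1) - 1)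
              * Polynomial.X ^ ((p - 1) * u₂)
          + Polynomial.C (((p : ℤ) - 1) * (p ^ (e - 2 * d - 1) + (-1) ^ s * p ^ (m - d - 1)))
              * Polynomial.X ^ ((p - 1) * u₃) ∧
      CodeD.completeWeightEnumerator (CodeD.traceCode p (CodeD.definingSet p k a 0)) =
        MvPolynomial.X 0 ^ n
          + MvPolynomial.C ((p : ℤ) ^ e - p ^ (e - 2 * d))
              * (MvPolynomial.X 0 ^ v₁
                * ∏ ρ ∈ Finset.univ.erase (0 : ZMod p), MvPolynomial.X ρ ^ u₁)
          + MvPolynomial.C ((p : ℤ) ^ (e - 2 * d - 1) - (-1) ^ s * (p - 1) * p ^ (m - d - 1) - 1)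
              * (MvPolynomial.X 0 ^ v₂
                * ∏ ρ ∈ Finset.univ.erase (0 : ZMod p), MvPolynomial.X ρ ^ u₂)
          + MvPolynomial.C (((p : ℤ) - 1) * (p ^ (e - 2 * d - 1) + (-1) ^ s * p ^ (m - d - 1)))
              * (MvPolynomial.X 0 ^ v₃
                * ∏ ρ ∈ Finset.univ.erase (0 : ZMod p), MvPolynomial.X ρ ^ u₃) := by
  classical
  have hpp : p.Prime := Fact.out
  have hd0 : d ≠ 0 := hd ▸ (Nat.gcd_pos_of_pos_left e hk).ne'
  have hdk : d ∣ k := hd ▸ Nat.gcd_dvd_left k e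
  have hde : d ∣ e := hd ▸ Nat.gcd_dvd_right k e
  have hmd : m = d * s := by
    obtain ⟨f, hf⟩ := hed.two_dvd
    have h1 : e = d * (2 * f) := by rw [← hf, Nat.mul_div_cancel' hde]
    have h2 : m = d * f := by
      have : 2 * m = 2 * (d * f) := by rw [← he, h1]; ring
      omega
    rw [hs, h2, Nat.mul_div_cancel_left _ (Nat.pos_of_ne_zero hd0)]
  have hn : Odd (k / d) := by
    rw [hd] at hed ⊢
    exact odd_div_gcd_of_even_div hk hed
  have hkn : k = d * (k / d) := (Nat.mul_div_cancel' hdk).symm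
  have hgcd : (2 * k).gcd e = 2 * d := by
    rw [hd] at hed ⊢
    exact gcd_two_mul_of_even_div hk hed
  obtain ⟨ψ, hψ⟩ : ∃ ψ : AddChar (ZMod p) ℂ, ψ ≠ 1 := by
    refine ⟨ZMod.stdAddChar, fun h => ?_⟩
    have := ZMod.isPrimitive_stdAddChar p (one_ne_zero (α := ZMod p))
    rw [h] at this
    exact this (by ext; simp)
  have hS : ∀ y : ZMod p, y ≠ 0 → ∑ x, ψ (y * traceBilin p k a x x) =
      ((-(-1) ^ s * (p : ℤ) ^ (m + d) : ℤ) : ℂ) := fun y hy =>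
    quadSum_traceBilin hp hd0 hn hkn hmd he hgcd hF ha has hψ hy
  have hrad := card_radical_traceBilin (p := p) (k := k) hp hd0 hn hkn (hmd ▸ he) hgcd hF ha has
  clear hs hed hk hkn hn hgcd has hdk hde hd
  -- Every exponent is written in terms of `d` and of the slack `i` in `d + 1 < m`.
  obtain ⟨i, rfl⟩ : ∃ i, m = d + 2 + i := ⟨m - (d + 2), by omega⟩
  clear hmd hm
  subst he
  set ε : ℤ := (-1) ^ s with hε
  have hε1 : ε = 1 ∨ ε = -1 := neg_one_pow_eq_or ℤ s
  clear_value ε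
  have e1 : 2 * (d + 2 + i) - 1 = 2 * d + 2 * i + 3 := by omega
  have e2 : 2 * (d + 2 + i) - 2 = 2 * d + 2 * i + 2 := by omega
  have e3 : d + 2 + i + d - 1 = 2 * d + i + 1 := by omega
  have e4 : d + 2 + i + d - 2 = 2 * d + i := by omega
  have e5 : 2 * (d + 2 + i) - 2 * d = 2 * i + 4 := by omega
  have e6 : 2 * i + 4 - 1 = 2 * i + 3 := by omega
  have e7 : d + 2 + i - d - 1 = i + 1 := by omega
  have e8 : d + 2 + i + d = 2 * d + i + 2 := by omega
  have e9 : 2 * (d + 2 + i) = 2 * d + 2 * i + 4 := by omega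
  rw [e1, e2, e3, e4, e5, e6, e7]
  rw [e8] at hS
  rw [e9] at hF ⊢
  clear e1 e2 e3 e4 e5 e6 e7 e8 e9
  obtain ⟨u, v, hcls, hinj, hne, hlen, hu₀, hv₀, hu₁, hv₁, hu₂, hv₂, hC0, hC1, hC2⟩ :=
    exists_isSymbolClassification hp hd0 hε1 hF hψ hS hrad
  refine ⟨Fintype.card (CodeD.definingSet p k a 0), u 0, v 0, u 1, v 1, u 2, v 2, ?_, hu₀, hv₀,
    hu₁, hv₁, hu₂, hv₂, ⟨rfl, ?_⟩, hcls.isWeightCode hinj hne, ?_, ?_⟩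
  · rw [Fintype.card_coe, hlen]
  · have hfin : Module.finrank (ZMod p) F = 2 * d + 2 * i + 4 := by
      have h := Module.card_eq_pow_finrank (K := ZMod p) (V := F)
      rw [hF, ZMod.card] at h
      exact (Nat.pow_right_injective hpp.two_le h).symm
    rw [← hfin]
    exact LinearMap.finrank_range_of_inj hcls.injective
  · have h := hcls.weightEnumerator_eq
    rw [Fin.sum_univ_three, hC0, hC1, hC2, ZMod.card, ← add_assoc, ← add_assoc] at h
    exact h
  · have h := hcls.completeWeightEnumerator_eq
    rw [Fin.sum_univ_three, hC0, hC1, hC2, ← add_assoc, ← add_assoc] at h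
    exact h
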